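/- Let $N\ge 1$. Let $A$ be an $N\times N$ GUE matrix, i.e. a random complex Hermitian matrix whose independent entries (the real diagonal entries and the complex entries above the diagonal) have joint density proportional to $e^{-\mathrm{Tr}\,A^2}$ with respect to Lebesgue measure. For $\alpha>0$ consider either of the two random matrices $$A+i\alpha\,\mathrm{diag}(1,0,\dots,0),\qquad A+i\alpha\,\hat{\mathbf 1}\hat{\mathbf 1}^\dagger,\qquad \hat{\mathbf 1}:=N^{-1/2}(1,\dots,1)^T .$$ Then there is a constant $C_N>0$, depending only on $N$ (in particular not on $\alpha$, and the same for both matrices), such that for every $\alpha>0$ the unordered eigenvalues $z_l=x_l+iy_l$ ($l=1,\dots,N$), counted with algebraic multiplicity, have joint law given by the permutation-invariant probability measure on $\mathbb C^N$ $$C_N\prod_{l=1}^N e^{-(x_l^2-y_l^2)}\prod_{1\le j<k\le N}|z_k-z_j|^2\;\frac{e^{-\alpha^2}}{\alpha^{N-1}}\;\delta\Big(\alpha-\sum_{l=1}^N y_l\Big)\prod_{l=1}^N dx_l\,dy_l ,$$ supported on $y_l>0$ for all $l=1,\dots,N$. Here $\delta(\alpha-\sum_l y_l)\prod_l dy_l$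 is the measure on the hyperplane $\sum_l y_l=\alpha$ obtained by integrating out one of the variables $y_l$ against the delta function; that the law is the above measure means that for every measurable symmetric function $f\ge 0$ on $\mathbb C^N$ the expectation of $f(z_1,\dots,z_N)$ is the integral of $f$ against it. -/

import Mathlib

open MeasureTheory ProbabilityTheory

noncomputable section

namespace PerturbedGUE

/-- The independent entries of an `N × N` Hermitian matrix: the real diagonal entries and the
complex entries strictly above the diagonal. This is a product of copies of `ℝ` and `ℂ`, and carries
the product Lebesgue measure `volume`. -/
abbrev HermitianEntries (N : ℕ) : Type :=
  (Fin N → ℝ) × ({p : Fin N × Fin N // p.1 < p.2} → ℂ)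

/-- The Hermitian matrix with the given independent entries. -/
def hermitianOfEntries (N : ℕ) (h : HermitianEntries N) : Matrix (Fin N) (Fin N) ℂ :=
  Matrix.of fun i j =>
    if hij : i < j then h.2 ⟨(i, j), hij⟩
    else if hji : j < i then star (h.2 ⟨(j, i), hji⟩)
    else (h.1 i : ℂ)

/-- The measure `exp (-Tr A²) dA` on the independent entries of an `N × N` Hermitian matrix `A`
(not normalised; the trace of `A²` is real). -/
def gueWeight (N : ℕ) : Measure (HermitianEntries N) :=
  volume.withDensity fun h =>
    ENNReal.ofReal
      (Real.exp (-(Matrix.trace (hermitianOfEntries N h * hermitianOfEntries N h)).re))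

/-- The law of the entries of a GUE matrix: the probability measure proportional to
`exp (-Tr A²) dA`. -/
def gueEntriesLaw (N : ℕ) : Measure (HermitianEntries N) :=
  (gueWeight N Set.univ)⁻¹ • gueWeight N

/-- `A` is a GUE random matrix on the probability space `(Ω, P)`: its entries above and on the
diagonal have the joint law proportional to `exp (-Tr A²) dA`, the remaining ones being determined
by Hermitian symmetry. -/
def IsGUE {Ω : Type*} [MeasurableSpace Ω] (N : ℕ) (A : Ω → Matrix (Fin N) (Fin N) ℂ)
    (P : Measure Ω) : Prop :=
  ∃ h : Ω → HermitianEntries N,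
    HasLaw h (gueEntriesLaw N) P ∧ ∀ ω, A ω = hermitianOfEntries N (h ω)

/-- The matrix `diag (1, 0, …, 0)`. -/
def diagOne (N : ℕ) [NeZero N] : Matrix (Fin N) (Fin N) ℂ :=
  Matrix.diagonal fun i => if i = 0 then 1 else 0

/-- The unit column vector in `ℂ^N` with all entries equal, i.e. equal to `1 / √N`. -/
def unitOnes (N : ℕ) : Fin N → ℂ := fun _ => ((1 / Real.sqrt N : ℝ) : ℂ)

/-- The rank one projection `v v†` for the column vector `v` with all entries equal to `1 / √N`. -/
def onesProjection (N : ℕ) : Matrix (Fin N) (Fin N) ℂ :=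
  Matrix.vecMulVec (unitOnes N) (star (unitOnes N))

/-- The measure `δ (α - ∑ y_l) dy_0 ⋯ dy_{N-1}` on `ℝ^N`: the variable `y_0` is integrated against
the delta function and so equals `α - ∑_{l ≠ 0} y_l`, while the variables `y_l` with `l ≠ 0` carry
Lebesgue measure. -/
def deltaSum (N : ℕ) [NeZero N] (α : ℝ) : Measure (Fin N → ℝ) :=
  (volume : Measure ({l : Fin N // l ≠ 0} → ℝ)).map fun y l =>
    if hl : l = 0 then α - ∑ k, y k else y ⟨l, hl⟩

/-- The measure `δ (α - ∑ y_l) ∏ dx_l dy_l` on `ℂ^N`, where `z_l = x_l + i y_l`. -/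
def deltaSumIm (N : ℕ) [NeZero N] (α : ℝ) : Measure (Fin N → ℂ) :=
  ((volume : Measure (Fin N → ℝ)).prod (deltaSum N α)).map fun p l => (⟨p.1 l, p.2 l⟩ : ℂ)

/-- The function `∏ exp (-(x_l² - y_l²)) ∏_{j < k} |z_k - z_j|² exp (-α²) / α^(N-1)`. -/
def eigenvalueWeight (N : ℕ) (α : ℝ) (z : Fin N → ℂ) : ℝ :=
  (∏ l, Real.exp (-((z l).re ^ 2 - (z l).im ^ 2))) *
    (∏ j, ∏ k ∈ Finset.Ioi j, ‖z k - z j‖ ^ 2) *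
      (Real.exp (-α ^ 2) / α ^ (N - 1))

/-- The measure on `ℂ^N` supported on `y_l > 0` for all `l`, with density `C * eigenvalueWeight N α`
with respect to `δ (α - ∑ y_l) ∏ dx_l dy_l`. -/
def eigenvalueMeasure (N : ℕ) [NeZero N] (C α : ℝ) : Measure (Fin N → ℂ) :=
  ((deltaSumIm N α).restrict {z | ∀ l, 0 < (z l).im}).withDensity fun z =>
    ENNReal.ofReal (C * eigenvalueWeight N α z)

/-- `μ` is the joint law of the (unordered) eigenvalues, counted with algebraic multiplicity, of the
random matrix `M`: `μ` is invariant under permutations of the coordinates, and for every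
enumeration `z ω` of the eigenvalues of `M ω` and every symmetric measurable test function `f` the
expectation of `f (z_1, …, z_N)` is the integral of `f` against `μ`. -/
structure IsEigenvalueLaw {Ω : Type*} [MeasurableSpace Ω] {N : ℕ}
    (M : Ω → Matrix (Fin N) (Fin N) ℂ) (P : Measure Ω) (μ : Measure (Fin N → ℂ)) : Prop where
  symmetric : ∀ σ : Equiv.Perm (Fin N), μ.map (fun z => z ∘ σ) = μ
  lintegral_eq : ∀ z : Ω → Fin N → ℂ,
    (∀ ω, (M ω).charpoly.roots = Finset.univ.val.map (z ω)) →
    ∀ f : (Fin N → ℂ) → ENNReal, Measurable f →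
      (∀ (σ : Equiv.Perm (Fin N)) (w : Fin N → ℂ), f (w ∘ σ) = f w) →
      ∫⁻ ω, f (z ω) ∂P = ∫⁻ w, f w ∂μ

end PerturbedGUE

end

/-! Write N = n + 1. For a unit vector v the characteristic polynomial of A + iα v v† is p - iα q,
where p is that of A and q = v† adj(X - A) v is monic and real of degree n
(`charpoly_perturbation`). The eigenvalues are thus a function of the real pair (p, q), and the
proof computes the law of this pair under Lebesgue measure dA, then changes variables to the roots.

The law of (p, q) is a constant times Lebesgue measure on strictly interlacing pairs
(`exists_lintegral_charCoeffs`). Conjugation by a reflection preserves dA, so v may be taken to be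
the first coordinate vector, and q is then the characteristic polynomial of the lower right block.
Bordering that block by a corner a and a column b gives p = (X - a) q - r q', where r = |b|² and q'
belongs to the block in the direction b/|b|: one step of Euclid's algorithm. By induction the law of
(q, q') does not depend on the direction of b. Polar coordinates give r the density r^n dr up to a
constant, which is the Jacobian of (a, r, q') ↦ p for fixed q (`lintegral_interlaced_succ`).

By Hermite–Biehler (`interlaced_iff_im_pos`), interlacing of p and q means that all roots of p - iα
q lie in the upper half plane. As q is monic, the coefficient of X^n has imaginary part -α, hence
the delta function; scaling the n other coefficients of q by α yields α^(1-N)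
(`lintegral_perturbedCoeffs`). Passing from coefficients to roots with a given sum costs
|Vandermonde|² (`lintegral_lowerCoeffs`) and N! orderings. Finally Tr A² = ∑ (x² - y²) + α²
(`re_trace_mul_self`) turns the Gaussian weight into a function of the roots. -/

namespace PerturbedGUE

/-! ### Characteristic polynomials under bordering and rank one perturbation -/

section LinearAlgebra

open Matrix Polynomial

variable {R m : Type*} [CommRing R] [Fintype m] [DecidableEq m]

/-- The determinant of a bordered matrix is affine in the corner entry. -/
theorem det_fromBlocks_corner (d : R) (u w : m → R) (M : Matrix m m R) :
    (fromBlocks (of fun _ _ : Unit => d) (replicateRow Unit w) (replicateCol Unit u) M).det =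
      (d - 1) * M.det + (M - vecMulVec u w).det := by
  set B := fromBlocks (1 : Matrix Unit Unit R) (replicateRow Unit w) (replicateCol Unit u) M
    with hB
  -- The first row is the one with corner 1 plus d - 1 times a unit row; linearity in that row
  -- leaves two Schur complements.
  have h1 : fromBlocks (of fun _ _ : Unit => d) (replicateRow Unit w) (replicateCol Unit u) M =
      B.updateRow (Sum.inl ()) (B (Sum.inl ()) +
        (d - 1) • (Sum.elim (fun _ => 1) 0 : Unit ⊕ m → R)) := by
    ext i j
    rcases i with i | i <;> rcases j with j | j <;> simp [hB, updateRow_apply]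
  have h2 : (B.updateRow (Sum.inl ()) (Sum.elim (fun _ => 1) 0 : Unit ⊕ m → R)) =
      fromBlocks (1 : Matrix Unit Unit R) 0 (replicateCol Unit u) M := by
    ext i j
    rcases i with i | i <;> rcases j with j | j <;> simp [hB, updateRow_apply]
  rw [h1, det_updateRow_add, det_updateRow_smul, h2, updateRow_eq_self, hB,
    det_fromBlocks_one₁₁, det_fromBlocks_zero₁₂, add_comm, vecMulVec_eq Unit]
  simp

/-- The determinant is affine along a rank one line. -/
theorem det_sub_smul_vecMulVec (t : R) (u w : m → R) (M : Matrix m m R) :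
    (M - t • vecMulVec u w).det = M.det - t * (M.det - (M - vecMulVec u w).det) := by
  have key : ∀ s : R, (M - s • vecMulVec u w).det =
      (fromBlocks (1 : Matrix Unit Unit R) (replicateRow Unit (s • w))
        (replicateCol Unit u) M).det := by
    intro s
    rw [det_fromBlocks_one₁₁, ← vecMulVec_smul, vecMulVec_eq Unit]
  set B := fromBlocks (1 : Matrix Unit Unit R) (replicateRow Unit w) (replicateCol Unit u) M
    with hB
  -- Bordering moves the parameter into a single row, which is an affine combination of the row for
  -- t = 1 and the unit row.
  have h1 : fromBlocks (1 : Matrix Unit Unit R) (replicateRow Unit (t • w))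
        (replicateCol Unit u) M =
      B.updateRow (Sum.inl ()) (t • B (Sum.inl ()) +
        (1 - t) • (Sum.elim (fun _ => 1) 0 : Unit ⊕ m → R)) := by
    ext i j
    rcases i with i | i <;> rcases j with j | j <;> simp [hB, updateRow_apply]
  have h2 : (B.updateRow (Sum.inl ()) (Sum.elim (fun _ => 1) 0 : Unit ⊕ m → R)) =
      fromBlocks (1 : Matrix Unit Unit R) 0 (replicateCol Unit u) M := by
    ext i j
    rcases i with i | i <;> rcases j with j | j <;> simp [hB, updateRow_apply]
  have h3 : (M - vecMulVec u w).det = B.det := by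
    have := key 1
    rwa [one_smul, one_smul] at this
  rw [key t, h1, det_updateRow_add, det_updateRow_smul, det_updateRow_smul, h2,
    updateRow_eq_self, det_fromBlocks_zero₁₂, h3]
  simp
  ring

theorem charmatrix_add_smul_vecMulVec (t : R) (u w : m → R) (A : Matrix m m R) :
    charmatrix (A + t • vecMulVec u w) =
      charmatrix A - C t • vecMulVec (fun i => C (u i)) (fun i => C (w i)) := by
  ext1 i j
  simp [charmatrix, vecMulVec_apply]
  ring

/-- An affine function of t is fixed by its values at 0 and 1. The imaginary perturbation is thereby
expressed through two Hermitian matrices, A and A + v v†. -/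
theorem charpoly_add_smul_vecMulVec (t : R) (u w : m → R) (A : Matrix m m R) :
    (A + t • vecMulVec u w).charpoly =
      A.charpoly - C t * (A.charpoly - (A + vecMulVec u w).charpoly) := by
  have h := charmatrix_add_smul_vecMulVec 1 u w A
  rw [one_smul, C_1, one_smul] at h
  simp only [charpoly, charmatrix_add_smul_vecMulVec, det_sub_smul_vecMulVec, h]

/-- Schur complement for the first row and column. The adjugate term is written as a difference of
two characteristic polynomials, which accounts for the extra -1 beside the corner. -/
theorem charpoly_fin_succ {n : ℕ} (A : Matrix (Fin (n + 1)) (Fin (n + 1)) R) :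
    A.charpoly = (X - C (A 0 0) - 1) * (A.submatrix Fin.succ Fin.succ).charpoly +
      (A.submatrix Fin.succ Fin.succ +
        vecMulVec (fun i : Fin n => A i.succ 0) (fun j : Fin n => A 0 j.succ)).charpoly := by
  let e : Unit ⊕ Fin n ≃ Fin (n + 1) :=
    ((Equiv.optionEquivSumPUnit (Fin n)).symm.trans (finSuccEquiv n).symm |>
      (Equiv.sumComm Unit (Fin n)).trans)
  have e0 : ∀ x, e (Sum.inl x) = 0 := fun x => by simp [e]
  have e1 : ∀ i, e (Sum.inr i) = i.succ := fun i => by simp [e]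
  have h := charmatrix_add_smul_vecMulVec 1 (fun i : Fin n => A i.succ 0)
    (fun j : Fin n => A 0 j.succ) (A.submatrix Fin.succ Fin.succ)
  rw [one_smul, C_1, one_smul] at h
  have h2 : (charmatrix A).submatrix e e =
      fromBlocks (of fun _ _ : Unit => X - C (A 0 0))
        (replicateRow Unit fun j : Fin n => - C (A 0 j.succ))
        (replicateCol Unit fun i : Fin n => - C (A i.succ 0))
        (charmatrix (A.submatrix Fin.succ Fin.succ)) := by
    ext1 i j
    rcases i with i | i <;> rcases j with j | j <;>
      simp [e0, e1, charmatrix, diagonal_apply, (Fin.succ_ne_zero _).symm]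
  have h3 : vecMulVec (fun i : Fin n => - C (A i.succ 0)) (fun j : Fin n => - C (A 0 j.succ)) =
      vecMulVec (fun i : Fin n => C (A i.succ 0)) (fun j : Fin n => C (A 0 j.succ)) := by
    ext1 i j
    simp [vecMulVec_apply]
  rw [charpoly, ← det_submatrix_equiv_self e, h2, det_fromBlocks_corner, h3, ← h]
  rfl

/-- For a rank one perturbation of `A` in the direction `b`, the polynomial `b† adj (X - A) b`. -/
noncomputable def resolventPoly (A : Matrix m m ℂ) (b : m → ℂ) : ℂ[X] :=
  A.charpoly - (A + vecMulVec b (star b)).charpoly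

theorem charpoly_add_smul (t : ℂ) (b : m → ℂ) (A : Matrix m m ℂ) :
    (A + t • vecMulVec b (star b)).charpoly = A.charpoly - C t * resolventPoly A b :=
  charpoly_add_smul_vecMulVec t b (star b) A

theorem resolventPoly_smul (t : ℂ) (b : m → ℂ) (A : Matrix m m ℂ) :
    resolventPoly A (t • b) = C (t * star t) * resolventPoly A b := by
  have h : vecMulVec (t • b) (star (t • b)) = (t * star t) • vecMulVec b (star b) := by
    ext i j; simp [vecMulVec_apply]; ring
  rw [resolventPoly, h, charpoly_add_smul]
  ring

/-- Both bordered expansions share the same block, border and hence the same second term; only the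
corner entry differs, by one. -/
theorem resolventPoly_single {n : ℕ} (A : Matrix (Fin (n + 1)) (Fin (n + 1)) ℂ) :
    resolventPoly A (Pi.single 0 1) = (A.submatrix Fin.succ Fin.succ).charpoly := by
  have hs : (A + vecMulVec (Pi.single 0 1) (star (Pi.single 0 1 : Fin (n + 1) → ℂ))).submatrix
      Fin.succ Fin.succ = A.submatrix Fin.succ Fin.succ := by
    ext i j
    simp [vecMulVec_apply]
  rw [resolventPoly, charpoly_fin_succ A, charpoly_fin_succ (A + _), hs]
  simp [vecMulVec_apply]
  ring

/-- This is the Euclidean recursion: dividing by the characteristic polynomial of the block leaves a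
remainder of the same nature one dimension lower. -/
theorem charpoly_fin_succ_hermitian {n : ℕ} {A : Matrix (Fin (n + 1)) (Fin (n + 1)) ℂ}
    (hA : A.IsHermitian) :
    A.charpoly = (X - C (A 0 0)) * (A.submatrix Fin.succ Fin.succ).charpoly -
      resolventPoly (A.submatrix Fin.succ Fin.succ) (fun i => A i.succ 0) := by
  have h : (fun j : Fin n => A 0 j.succ) = star (fun i : Fin n => A i.succ 0) := by
    ext j
    simp [hA.apply]
  rw [charpoly_fin_succ, resolventPoly, h]
  ring

theorem charpoly_conj {U : Matrix m m ℂ} (hU : U * U = 1) (A : Matrix m m ℂ) :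
    (U * A * U).charpoly = A.charpoly := by
  rw [charpoly_mul_comm, ← Matrix.mul_assoc, hU, Matrix.one_mul]

theorem resolventPoly_conj {U : Matrix m m ℂ} (hU : U * U = 1) (hH : U.IsHermitian)
    (A : Matrix m m ℂ) (b : m → ℂ) :
    resolventPoly (U * A * U) (U *ᵥ b) = resolventPoly A b := by
  have h : U * A * U + vecMulVec (U *ᵥ b) (star (U *ᵥ b)) =
      U * (A + vecMulVec b (star b)) * U := by
    rw [Matrix.mul_add, Matrix.add_mul, star_mulVec, hH.eq, ← mul_vecMulVec, ← vecMulVec_mul]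
    simp [Matrix.mul_assoc]
  rw [resolventPoly, h, charpoly_conj hU, charpoly_conj hU]
  rfl

omit [Fintype m] [DecidableEq m] in
theorem isHermitian_vecMulVec_star (b : m → ℂ) : (vecMulVec b (star b)).IsHermitian := by
  ext i j
  simp [vecMulVec_apply, mul_comm]

/-- A unit vector is, up to a phase, the image of a coordinate vector under a Hermitian unitary
matrix. -/
theorem exists_reflection {n : ℕ} (v : Fin (n + 1) → ℂ) (hv : v ⬝ᵥ star v = 1) :
    ∃ (U : Matrix (Fin (n + 1)) (Fin (n + 1)) ℂ) (θ : ℂ), U * U = 1 ∧ U.IsHermitian ∧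
      θ * star θ = 1 ∧ U *ᵥ (Pi.single 0 1) = θ • v := by
  -- The phase makes the first coordinate of w = θ v equal to -r ≤ 0. Then |e - w|² = 2 (1 + r)
  -- cannot vanish and the Householder reflection in e - w is defined. The phase does no harm, since
  -- `resolventPoly` sees only θ θ̄.
  obtain ⟨θ, r, hθ, hr, h0⟩ : ∃ (θ : ℂ) (r : ℝ), θ * star θ = 1 ∧ 0 ≤ r ∧ θ * v 0 = -(r : ℂ) := by
    by_cases h : v 0 = 0
    · exact ⟨1, 0, by simp, le_rfl, by simp [h]⟩
    · have hn : (‖v 0‖ : ℂ) ≠ 0 := by simpa using h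
      have hm : v 0 * star (v 0) = (‖v 0‖ : ℂ) ^ 2 := Complex.mul_conj' (v 0)
      refine ⟨-star (v 0) / ‖v 0‖, ‖v 0‖, ?_, norm_nonneg _, ?_⟩
      · have : star (‖v 0‖ : ℂ) = ‖v 0‖ := Complex.conj_ofReal _
        rw [star_div₀, star_neg, star_star, this]
        field_simp
        linear_combination hm
      · field_simp
        linear_combination -hm
  have hr1 : (1 + r : ℂ) ≠ 0 := by
    have : (0 : ℝ) < 1 + r := by positivity
    exact_mod_cast this.ne'
  set w := θ • v with hw
  have hw0 : w 0 = -(r : ℂ) := h0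
  have hsr : star (r : ℂ) = r := Complex.conj_ofReal r
  have hww : w ⬝ᵥ star w = 1 := by
    rw [hw, star_smul, smul_dotProduct, dotProduct_smul, hv]
    simpa using hθ
  set e : Fin (n + 1) → ℂ := Pi.single 0 1 with he
  have hse : star e = e := by
    rw [he, ← Pi.single_star, star_one]
  set u := e - w with hu
  have huu : star u ⬝ᵥ u = 2 * (1 + r) := by
    rw [dotProduct_comm, hu, star_sub, hse, sub_dotProduct, dotProduct_sub, dotProduct_sub, hww,
      he, single_dotProduct, single_dotProduct, dotProduct_single]
    simp [hw0]
    ring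
  have hue : star u ⬝ᵥ e = 1 + r := by
    rw [he, dotProduct_single]
    simp [hu, he, hw0]
  refine ⟨1 - (1 + r : ℂ)⁻¹ • vecMulVec u (star u), θ, ?_, ?_, hθ, ?_⟩
  · have h2 : vecMulVec u (star u) * vecMulVec u (star u) =
        (2 * (1 + r) : ℂ) • vecMulVec u (star u) := by
      rw [vecMulVec_mul_vecMulVec, huu, vecMulVec_smul]
    simp only [Matrix.sub_mul, Matrix.mul_sub, Matrix.one_mul, Matrix.mul_one,
      Matrix.smul_mul, Matrix.mul_smul, h2, smul_smul]
    have : (1 + r : ℂ)⁻¹ * (2 * (1 + r)) = 2 := by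
      field_simp
    rw [this]
    module
  · refine isHermitian_one.sub ?_
    rw [IsHermitian, conjTranspose_smul, (isHermitian_vecMulVec_star u).eq]
    simp
  · rw [sub_mulVec, one_mulVec, smul_mulVec, vecMulVec_mulVec, hue]
    ext i
    simp [hu]
    field_simp
    simp [hw]

/-- Entrywise conjugation of a Hermitian matrix is transposition, which preserves the characteristic
polynomial. -/
theorem IsHermitian.coeff_charpoly_im {A : Matrix m m ℂ} (hA : A.IsHermitian) (i : ℕ) :
    (A.charpoly.coeff i).im = 0 := by
  have h : A.charpoly.map (starRingEnd ℂ) = A.charpoly := by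
    rw [← charpoly_map, ← charpoly_transpose]
    exact congrArg charpoly hA
  rw [← Complex.conj_eq_iff_im, ← coeff_map, h]

theorem coeff_resolventPoly_im {A : Matrix m m ℂ} (hA : A.IsHermitian) (b : m → ℂ) (i : ℕ) :
    ((resolventPoly A b).coeff i).im = 0 := by
  rw [resolventPoly, coeff_sub, Complex.sub_im, IsHermitian.coeff_charpoly_im hA,
    IsHermitian.coeff_charpoly_im (hA.add (isHermitian_vecMulVec_star b)), sub_zero]

theorem resolventPoly_degree_lt {n : ℕ} (A : Matrix (Fin (n + 1)) (Fin (n + 1)) ℂ)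
    (b : Fin (n + 1) → ℂ) : (resolventPoly A b).degree < (n + 1 : ℕ) := by
  have h := degree_sub_lt_left (p := A.charpoly) (q := (A + vecMulVec b (star b)).charpoly)
    (by simp [charpoly_degree_eq_dim]) (charpoly_monic A).ne_zero
    (by rw [(charpoly_monic A).leadingCoeff, (charpoly_monic _).leadingCoeff])
  rw [charpoly_degree_eq_dim] at h
  simpa [resolventPoly] using h

/-- The subleading coefficients are minus the traces. For a unit vector this makes `resolventPoly`
monic of degree n. -/
theorem coeff_resolventPoly {n : ℕ} (A : Matrix (Fin (n + 1)) (Fin (n + 1)) ℂ)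
    (b : Fin (n + 1) → ℂ) : (resolventPoly A b).coeff n = b ⬝ᵥ star b := by
  have h1 := trace_eq_neg_charpoly_coeff A
  have h2 := trace_eq_neg_charpoly_coeff (A + vecMulVec b (star b))
  rw [trace_add, trace_vecMulVec] at h2
  simp only [Fintype.card_fin, Nat.add_sub_cancel] at h1 h2
  rw [resolventPoly, coeff_sub]
  linear_combination h1 - h2

end LinearAlgebra

/-! ### Interlacing through Euclid's algorithm, and the Hermite–Biehler theorem -/

section Interlacing

open Matrix Polynomial

/-- The monic polynomial of degree `n` with the given lower coefficients. -/
noncomputable def monicPoly {R : Type*} [CommRing R] {n : ℕ} (c : Fin n → R) : R[X] :=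
  X ^ n + ∑ i : Fin n, C (c i) * X ^ (i : ℕ)

section monicPoly

variable {R : Type*} [CommRing R] {n : ℕ}

theorem coeff_monicPoly (c : Fin n → R) (k : ℕ) :
    (monicPoly c).coeff k = if h : k < n then c ⟨k, h⟩ else if k = n then 1 else 0 := by
  simp only [monicPoly, coeff_add, coeff_X_pow, finsetSum_coeff, coeff_C_mul]
  by_cases h1 : k < n
  · rw [if_neg h1.ne, dif_pos h1, zero_add, Finset.sum_eq_single ⟨k, h1⟩]
    · simp
    · intro j _ hj
      rw [if_neg, mul_zero]
      rintro rfl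
      exact hj rfl
    · simp
  · rw [dif_neg h1, Finset.sum_eq_zero, add_zero]
    intro j _
    rw [if_neg (by omega), mul_zero]

@[simp] theorem coeff_monicPoly_fin (c : Fin n → R) (i : Fin n) : (monicPoly c).coeff i = c i := by
  simp [coeff_monicPoly]

@[simp] theorem coeff_monicPoly_self (c : Fin n → R) : (monicPoly c).coeff n = 1 := by
  simp [coeff_monicPoly]

theorem coeff_monicPoly_of_lt (c : Fin n → R) {k : ℕ} (h : n < k) :
    (monicPoly c).coeff k = 0 := by
  rw [coeff_monicPoly, dif_neg (by omega), if_neg (by omega)]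

theorem monicPoly_coeff {P : R[X]} (h1 : P.coeff n = 1) (h2 : ∀ k, n < k → P.coeff k = 0) :
    monicPoly (fun i : Fin n => P.coeff i) = P := by
  ext k
  rw [coeff_monicPoly]
  split_ifs with h h'
  · rfl
  · rw [h', h1]
  · rw [h2 k (by omega)]

theorem monicPoly_map {S : Type*} [CommRing S] (f : R →+* S) (c : Fin n → R) :
    (monicPoly c).map f = monicPoly (fun i => f (c i)) := by
  simp [monicPoly, Polynomial.map_sum]

theorem monicPoly_injective : Function.Injective (monicPoly : (Fin n → R) → R[X]) := by
  intro c d h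
  ext i
  rw [← coeff_monicPoly_fin c, h, coeff_monicPoly_fin]

end monicPoly

/-- The quotient `X - a` in the division of `p` by `q` has this `a`. -/
def quotientShift {n : ℕ} (p : Fin (n + 2) → ℝ) (q : Fin (n + 1) → ℝ) : ℝ :=
  q (Fin.last n) - p (Fin.last (n + 1))

/-- Minus the remainder in the division of `p` by `q`. -/
noncomputable def negRemainder {n : ℕ} (p : Fin (n + 2) → ℝ) (q : Fin (n + 1) → ℝ) : ℝ[X] :=
  (X - C (quotientShift p q)) * monicPoly q - monicPoly p

/-- Strict interlacing of the real monic polynomials with coefficient vectors `p` and `q`, expressed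
through the Euclidean algorithm. -/
def Interlaced : (n : ℕ) → (Fin (n + 1) → ℝ) → (Fin n → ℝ) → Prop
  -- Degree one against the constant 1 carries no condition.
  | 0, _, _ => True
  | n + 1, p, q => 0 < (negRemainder p q).coeff n ∧
      Interlaced n q (fun i => (negRemainder p q).coeff i / (negRemainder p q).coeff n)

/-- The coefficients of `(X - a) q - s` for a polynomial `s` of lower degree. -/
noncomputable def euclidStep {n : ℕ} (a : ℝ) (q : Fin (n + 1) → ℝ) (s : ℝ[X]) : Fin (n + 2) → ℝ :=
  fun i => ((X - C a) * monicPoly q - s).coeff i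

section euclidStep

variable {n : ℕ} {a : ℝ} {q : Fin (n + 1) → ℝ} {s : ℝ[X]}

theorem monicPoly_euclidStep (hs : ∀ k, n < k → s.coeff k = 0) :
    monicPoly (euclidStep a q s) = (X - C a) * monicPoly q - s := by
  apply monicPoly_coeff
  · rw [sub_mul, coeff_sub, coeff_sub, coeff_X_mul, hs _ (by omega), coeff_C_mul,
      coeff_monicPoly_self, coeff_monicPoly_of_lt _ (by omega)]
    simp
  · intro k hk
    obtain ⟨k, rfl⟩ : ∃ j, k = j + 1 := ⟨k - 1, by omega⟩
    rw [sub_mul, coeff_sub, coeff_sub, coeff_X_mul, hs _ (by omega), coeff_C_mul,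
      coeff_monicPoly_of_lt _ (by omega), coeff_monicPoly_of_lt _ (by omega)]
    simp

theorem quotientShift_euclidStep (hs : ∀ k, n < k → s.coeff k = 0) :
    quotientShift (euclidStep a q s) q = a := by
  rw [quotientShift, euclidStep, sub_mul, coeff_sub, coeff_sub, Fin.val_last, coeff_X_mul,
    coeff_C_mul, coeff_monicPoly_self, hs _ (by omega)]
  have := coeff_monicPoly_fin q (Fin.last n)
  rw [Fin.val_last] at this
  rw [this]
  ring

theorem negRemainder_euclidStep (hs : ∀ k, n < k → s.coeff k = 0) :
    negRemainder (euclidStep a q s) q = s := by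
  rw [negRemainder, quotientShift_euclidStep hs, monicPoly_euclidStep hs]
  ring

theorem coeff_negRemainder_of_lt (p : Fin (n + 2) → ℝ) (q : Fin (n + 1) → ℝ) {k : ℕ}
    (hk : n < k) : (negRemainder p q).coeff k = 0 := by
  obtain ⟨k, rfl⟩ : ∃ j, k = j + 1 := ⟨k - 1, by omega⟩
  rw [negRemainder, sub_mul, coeff_sub, coeff_sub, coeff_X_mul, coeff_C_mul]
  rcases (by omega : k = n ∨ k = n + 1 ∨ n + 1 < k) with rfl | rfl | h
  · have h1 := coeff_monicPoly_fin q (Fin.last k)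
    have h2 := coeff_monicPoly_fin p (Fin.last (k + 1))
    rw [Fin.val_last] at h1 h2
    rw [h1, h2, coeff_monicPoly_self, quotientShift]
    ring
  · rw [coeff_monicPoly_self, coeff_monicPoly_self, coeff_monicPoly_of_lt _ (by omega)]
    ring
  · rw [coeff_monicPoly_of_lt _ (by omega), coeff_monicPoly_of_lt _ (by omega),
      coeff_monicPoly_of_lt _ (by omega)]
    ring

/-- Quotient and remainder are unique, so division recovers a, r and q'. These are therefore
coordinates on interlacing pairs one degree higher. -/
theorem interlaced_euclidStep (r : ℝ) (q' : Fin n → ℝ) :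
    Interlaced (n + 1) (euclidStep a q (C r * monicPoly q')) q ↔ 0 < r ∧ Interlaced n q q' := by
  have hs : ∀ k, n < k → (C r * monicPoly q').coeff k = 0 := fun k hk => by
    rw [coeff_C_mul, coeff_monicPoly_of_lt _ hk, mul_zero]
  rw [Interlaced, negRemainder_euclidStep hs, coeff_C_mul, coeff_monicPoly_self, mul_one]
  refine and_congr_right fun hr => ?_
  have : (fun i : Fin n => (C r * monicPoly q').coeff i / r) = q' := by
    ext i
    rw [coeff_C_mul, coeff_monicPoly_fin, mul_div_cancel_left₀ _ hr.ne']
  rw [this]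

theorem Interlaced.exists_eq {p : Fin (n + 2) → ℝ} {q : Fin (n + 1) → ℝ}
    (h : Interlaced (n + 1) p q) : ∃ (a r : ℝ) (q' : Fin n → ℝ), 0 < r ∧ Interlaced n q q' ∧
      monicPoly p = (X - C a) * monicPoly q - C r * monicPoly q' := by
  obtain ⟨hr, hi⟩ := h
  set r := (negRemainder p q).coeff n
  refine ⟨quotientShift p q, r, _, hr, hi, ?_⟩
  have h2 : C r * monicPoly (fun i : Fin n => (negRemainder p q).coeff i / r) =
      negRemainder p q := by
    ext k
    rw [coeff_C_mul, coeff_monicPoly]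
    split_ifs with h h'
    · exact mul_div_cancel₀ _ hr.ne'
    · rw [h', mul_one]
    · rw [mul_zero, coeff_negRemainder_of_lt _ _ (by omega)]
  rw [h2, negRemainder]
  ring

end euclidStep

/-- Along the continued fraction p/q = z - a - r/(q/q'), one has Im(p q̄) = Im z |q|² + r Im(q q̄'),
and the last term is nonpositive by induction. Multiplying out by q̄ avoids dividing by zeros of q;
common zeros are excluded by descending the recursion. -/
theorem Interlaced.im_mul_conj_le {n : ℕ} {p : Fin (n + 1) → ℝ} {q : Fin n → ℝ}
    (h : Interlaced n p q) {z : ℂ} (hz : z.im ≤ 0) :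
    (aeval z (monicPoly p) * star (aeval z (monicPoly q))).im ≤
        z.im * Complex.normSq (aeval z (monicPoly q)) ∧
      ¬ (aeval z (monicPoly p) = 0 ∧ aeval z (monicPoly q) = 0) := by
  induction n with
  | zero => simp [monicPoly]
  | succ n ih =>
    obtain ⟨a, r, q', hr, hi, hp⟩ := h.exists_eq
    obtain ⟨h1, h2⟩ := ih hi
    have hP : aeval z (monicPoly p) =
        (z - a) * aeval z (monicPoly q) - r * aeval z (monicPoly q') := by
      rw [hp]; simp
    rw [hP]
    set Q := aeval z (monicPoly q)
    set S := aeval z (monicPoly q')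
    refine ⟨?_, ?_⟩
    · have h3 : (((z - a) * Q - r * S) * star Q).im =
          z.im * Complex.normSq Q + r * (Q * star S).im := by
        simp [Complex.normSq_apply]
        ring
      rw [h3]
      have h4 : z.im * Complex.normSq S ≤ 0 :=
        mul_nonpos_of_nonpos_of_nonneg hz (Complex.normSq_nonneg _)
      nlinarith
    · rintro ⟨h3, h4⟩
      refine h2 ⟨h4, ?_⟩
      rw [h4, mul_zero, zero_sub, neg_eq_zero] at h3
      have : (r : ℂ) ≠ 0 := by exact_mod_cast hr.ne'
      simpa [this] using h3

/-- If `p` and `q` interlace then `p - i α q` has its roots in the upper half plane. -/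
theorem Interlaced.im_pos {n : ℕ} {p : Fin (n + 1) → ℝ} {q : Fin n → ℝ}
    (h : Interlaced n p q) {α : ℝ} (hα : 0 < α) {z : ℂ}
    (hz : aeval z (monicPoly p) = Complex.I * α * aeval z (monicPoly q)) : 0 < z.im := by
  by_contra hneg
  obtain ⟨h1, h2⟩ := h.im_mul_conj_le (not_lt.mp hneg)
  rw [hz] at h1 h2
  set Q := aeval z (monicPoly q)
  -- At a root p q̄ = iα |q|², whose nonnegative imaginary part meets the nonpositive bound; q and
  -- then p vanish, contradicting coprimality.
  have h3 : (Complex.I * α * Q * star Q).im = α * Complex.normSq Q := by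
    simp [Complex.normSq_apply]
    ring
  rw [h3] at h1
  have h4 : z.im * Complex.normSq Q ≤ 0 :=
    mul_nonpos_of_nonpos_of_nonneg (not_lt.mp hneg) (Complex.normSq_nonneg _)
  have h5 : Complex.normSq Q = 0 := by
    have := Complex.normSq_nonneg Q
    nlinarith
  rw [Complex.normSq_eq_zero] at h5
  exact h2 ⟨by simp [h5], h5⟩

/-- The real coefficients of the characteristic polynomial of a Hermitian matrix. -/
noncomputable def charCoeffs {n : ℕ} (A : Matrix (Fin n) (Fin n) ℂ) : Fin n → ℝ :=
  fun i => (A.charpoly.coeff i).re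

/-- The real coefficients of `resolventPoly A v`. -/
noncomputable def resolventCoeffs {n : ℕ} (A : Matrix (Fin (n + 1)) (Fin (n + 1)) ℂ)
    (v : Fin (n + 1) → ℂ) : Fin n → ℝ :=
  fun i => ((resolventPoly A v).coeff i).re

theorem map_monicPoly_charCoeffs {n : ℕ} {A : Matrix (Fin n) (Fin n) ℂ} (hA : A.IsHermitian) :
    (monicPoly (charCoeffs A)).map Complex.ofRealHom = A.charpoly := by
  have hd : A.charpoly.natDegree = n := by simp [charpoly_natDegree_eq_dim]
  rw [monicPoly_map, ← monicPoly_coeff (P := A.charpoly) (n := n)]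
  · congr 1
    ext i
    exact Complex.ext (by simp [charCoeffs]) (by simp [IsHermitian.coeff_charpoly_im hA])
  · have := (charpoly_monic A).coeff_natDegree
    rwa [hd] at this
  · intro k hk
    exact coeff_eq_zero_of_natDegree_lt (by omega)

theorem coeff_resolventPoly_of_lt {n : ℕ} (A : Matrix (Fin (n + 1)) (Fin (n + 1)) ℂ)
    (v : Fin (n + 1) → ℂ) {k : ℕ} (hk : n < k) : (resolventPoly A v).coeff k = 0 :=
  coeff_eq_zero_of_degree_lt
    ((resolventPoly_degree_lt A v).trans_le (by exact_mod_cast hk))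

theorem map_monicPoly_resolventCoeffs {n : ℕ} {A : Matrix (Fin (n + 1)) (Fin (n + 1)) ℂ}
    (hA : A.IsHermitian) {v : Fin (n + 1) → ℂ} (hv : v ⬝ᵥ star v = 1) :
    (monicPoly (resolventCoeffs A v)).map Complex.ofRealHom = resolventPoly A v := by
  rw [monicPoly_map, ← monicPoly_coeff (P := resolventPoly A v) (n := n)]
  · congr 1
    ext i
    exact Complex.ext (by simp [resolventCoeffs]) (by simp [coeff_resolventPoly_im hA])
  · rw [coeff_resolventPoly, hv]
  · intro k hk
    exact coeff_resolventPoly_of_lt _ _ hk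

/-- The squared length of a vector. -/
noncomputable def sqLength {m : Type*} [Fintype m] (b : m → ℂ) : ℝ := ∑ i, ‖b i‖ ^ 2

theorem dotProduct_star_eq {m : Type*} [Fintype m] (b : m → ℂ) :
    b ⬝ᵥ star b = (sqLength b : ℂ) := by
  simp [dotProduct, sqLength, Complex.mul_conj']

theorem sqLength_pos {m : Type*} [Fintype m] {b : m → ℂ} (hb : b ≠ 0) : 0 < sqLength b := by
  obtain ⟨i, hi⟩ := Function.ne_iff.mp hb
  exact Finset.sum_pos' (fun i _ => by positivity)
    ⟨i, Finset.mem_univ _, by have : 0 < ‖b i‖ := norm_pos_iff.mpr hi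
                              positivity⟩

/-- The normalisation of a vector. -/
noncomputable def normalized {m : Type*} [Fintype m] (b : m → ℂ) : m → ℂ :=
  ((Real.sqrt (sqLength b))⁻¹ : ℂ) • b

theorem normalized_dotProduct {m : Type*} [Fintype m] {b : m → ℂ} (hb : b ≠ 0) :
    normalized b ⬝ᵥ star (normalized b) = 1 := by
  have h := sqLength_pos hb
  have h2 : (Real.sqrt (sqLength b) : ℂ) ^ 2 = sqLength b := by
    exact_mod_cast Real.sq_sqrt h.le
  have h3 : (Real.sqrt (sqLength b) : ℂ) ≠ 0 := by
    exact_mod_cast (Real.sqrt_pos.mpr h).ne'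
  rw [normalized, star_smul, smul_dotProduct, dotProduct_smul, dotProduct_star_eq, ← h2]
  simp
  field_simp

theorem resolventPoly_eq_normalized {n : ℕ} (A : Matrix (Fin (n + 1)) (Fin (n + 1)) ℂ)
    {b : Fin (n + 1) → ℂ} (hb : b ≠ 0) :
    resolventPoly A b = C (sqLength b : ℂ) * resolventPoly A (normalized b) := by
  have h := sqLength_pos hb
  have h2 : (Real.sqrt (sqLength b) : ℂ) ^ 2 = sqLength b := by
    exact_mod_cast Real.sq_sqrt h.le
  have h3 : (Real.sqrt (sqLength b) : ℂ) ≠ 0 := by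
    exact_mod_cast (Real.sqrt_pos.mpr h).ne'
  rw [normalized, resolventPoly_smul, ← mul_assoc, ← C_mul]
  have : (sqLength b : ℂ) * ((Real.sqrt (sqLength b) : ℂ)⁻¹ *
      star (Real.sqrt (sqLength b) : ℂ)⁻¹) = 1 := by
    rw [← h2]
    simp
    field_simp
  rw [this, C_1, one_mul]

theorem map_ofReal_injective :
    Function.Injective (Polynomial.map Complex.ofRealHom) :=
  Polynomial.map_injective _ Complex.ofReal_injective

/-- The Euclidean step performed by bordering a Hermitian matrix. -/
theorem charCoeffs_eq_euclidStep {n : ℕ} {A : Matrix (Fin (n + 2)) (Fin (n + 2)) ℂ}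
    (hA : A.IsHermitian) (hb : (fun i : Fin (n + 1) => A i.succ 0) ≠ 0) :
    charCoeffs A = euclidStep (A 0 0).re (charCoeffs (A.submatrix Fin.succ Fin.succ))
      (C (sqLength fun i : Fin (n + 1) => A i.succ 0) *
        monicPoly (resolventCoeffs (A.submatrix Fin.succ Fin.succ)
          (normalized fun i : Fin (n + 1) => A i.succ 0))) := by
  apply monicPoly_injective
  apply map_ofReal_injective
  have hA' : (A.submatrix Fin.succ Fin.succ).IsHermitian := hA.submatrix _
  have h00 : ((A 0 0).re : ℂ) = A 0 0 := hA.coe_re_apply_self 0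
  rw [map_monicPoly_charCoeffs hA, monicPoly_euclidStep, Polynomial.map_sub, Polynomial.map_mul,
    Polynomial.map_mul, map_monicPoly_charCoeffs hA',
    map_monicPoly_resolventCoeffs hA' (normalized_dotProduct hb), charpoly_fin_succ_hermitian hA,
    resolventPoly_eq_normalized _ hb]
  · simp [h00]
  · intro k hk
    rw [coeff_C_mul, coeff_monicPoly_of_lt _ hk, mul_zero]

theorem resolventCoeffs_single {n : ℕ} (A : Matrix (Fin (n + 1)) (Fin (n + 1)) ℂ) :
    resolventCoeffs A (Pi.single 0 1) = charCoeffs (A.submatrix Fin.succ Fin.succ) := by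
  ext i
  rw [resolventCoeffs, resolventPoly_single]
  rfl

theorem exists_reflection_resolventPoly {n : ℕ} (v : Fin (n + 1) → ℂ) (hv : v ⬝ᵥ star v = 1) :
    ∃ U : Matrix (Fin (n + 1)) (Fin (n + 1)) ℂ, U * U = 1 ∧ U.IsHermitian ∧
      ∀ A, resolventPoly (U * A * U) (Pi.single 0 1) = resolventPoly A v := by
  obtain ⟨U, θ, hU, hH, hθ, hv⟩ := exists_reflection v hv
  refine ⟨U, hU, hH, fun A => ?_⟩
  have h : Pi.single 0 1 = U *ᵥ (θ • v) := by
    rw [← hv, mulVec_mulVec, hU, one_mulVec]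
  rw [h, resolventPoly_conj hU hH, resolventPoly_smul, hθ, C_1, one_mul]

theorem isHermitian_conj {m : Type*} [Fintype m] {U A : Matrix m m ℂ} (hU : U.IsHermitian)
    (hA : A.IsHermitian) : (U * A * U).IsHermitian := by
  have := isHermitian_mul_mul_conjTranspose U hA
  rwa [hU.eq] at this

/-- Coprimality (that is, cyclicity of `v`) implies strict interlacing. -/
theorem interlaced_of_coprime {n : ℕ} {A : Matrix (Fin (n + 1)) (Fin (n + 1)) ℂ}
    (hA : A.IsHermitian) {v : Fin (n + 1) → ℂ} (hv : v ⬝ᵥ star v = 1)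
    (h : ∀ z, ¬ (A.charpoly.IsRoot z ∧ (resolventPoly A v).IsRoot z)) :
    Interlaced n (charCoeffs A) (resolventCoeffs A v) := by
  induction n with
  | zero => trivial
  | succ n ih =>
    obtain ⟨U, hU, hH, hs⟩ := exists_reflection_resolventPoly v hv
    set B := U * A * U with hB
    have hBH : B.IsHermitian := isHermitian_conj hH hA
    have hBc : B.charpoly = A.charpoly := charpoly_conj hU A
    have h1 : charCoeffs A = charCoeffs B := by
      ext i; rw [charCoeffs, charCoeffs, hBc]
    have h2 : resolventCoeffs A v = resolventCoeffs B (Pi.single 0 1) := by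
      ext i; rw [resolventCoeffs, resolventCoeffs, hs]
    rw [h1, h2, resolventCoeffs_single]
    rw [← hBc, ← hs A, ← hB, resolventPoly_single] at h
    have hp := charpoly_fin_succ_hermitian hBH
    have hB' : (B.submatrix Fin.succ Fin.succ).IsHermitian := hBH.submatrix _
    set B' := B.submatrix Fin.succ Fin.succ
    -- Without coupling to the border, the characteristic polynomial of the block divides that of B,
    -- so any root of the former is a common root.
    by_cases hb : (fun i : Fin (n + 1) => B i.succ 0) = 0
    · exfalso
      have h0 : resolventPoly B' (fun i : Fin (n + 1) => B i.succ 0) = 0 := by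
        rw [hb, resolventPoly]
        simp
      obtain ⟨z, hz⟩ := IsAlgClosed.exists_root B'.charpoly (by
        rw [charpoly_degree_eq_dim]; simp; exact_mod_cast Nat.succ_ne_zero n)
      refine h z ⟨?_, hz⟩
      rw [hp, h0, sub_zero, IsRoot.def, eval_mul, hz.eq_zero, mul_zero]
    · rw [charCoeffs_eq_euclidStep hBH hb, interlaced_euclidStep]
      refine ⟨sqLength_pos hb, ih hB' (normalized_dotProduct hb) ?_⟩
      -- By the recursion, a common root of q and q' is also one of p and q.
      rintro z ⟨hz1, hz2⟩
      refine h z ⟨?_, hz1⟩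
      rw [hp, resolventPoly_eq_normalized _ hb, IsRoot.def, eval_sub, eval_mul, eval_mul,
        hz1.eq_zero, hz2.eq_zero]
      simp

/-- A polynomial with roots in the upper half plane is the characteristic polynomial of a rank one
perturbation of a Hermitian matrix. -/
theorem exists_charpoly_eq_prod {n : ℕ} (z : Fin n → ℂ) (hz : ∀ i, 0 < (z i).im) :
    ∃ (A : Matrix (Fin n) (Fin n) ℂ) (v : Fin n → ℂ), A.IsHermitian ∧ (∀ i, v i ≠ 0) ∧
      (A + Complex.I • vecMulVec v (star v)).charpoly = ∏ i, (X - C (z i)) := by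
  -- With v_i = √(Im z_i), the off-diagonal entries ± i v_i v_j of A cancel those of i v v† below
  -- the diagonal. The sum is upper triangular with diagonal z.
  set y : Fin n → ℝ := fun i => Real.sqrt (z i).im with hy
  have hyy : ∀ i, (y i : ℂ) * y i = ((z i).im : ℂ) := fun i => by
    exact_mod_cast Real.mul_self_sqrt (hz i).le
  set v : Fin n → ℂ := fun i => (y i : ℂ) with hv
  set A : Matrix (Fin n) (Fin n) ℂ := of fun i j =>
    if i < j then Complex.I * y i * y j else if j < i then - (Complex.I * y i * y j)
    else ((z i).re : ℂ) with hAdef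
  have hAM : A + Complex.I • vecMulVec v (star v) = of fun i j =>
      if i < j then 2 * Complex.I * y i * y j else if j < i then 0 else z i := by
    ext i j
    simp only [hAdef, hv, Matrix.add_apply, of_apply, Matrix.smul_apply, vecMulVec_apply, Pi.star_apply,
      smul_eq_mul]
    have hs : star (y j : ℂ) = y j := Complex.conj_ofReal _
    rw [hs]
    split_ifs with h1 h2
    · ring
    · ring
    · obtain rfl : i = j := le_antisymm (not_lt.mp h2) (not_lt.mp h1)
      rw [hyy, mul_comm Complex.I, Complex.re_add_im]
  refine ⟨A, v, ?_, fun i => ?_, ?_⟩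
  · ext i j
    rw [conjTranspose_apply]
    simp only [hAdef, of_apply]
    split_ifs with h1 h2 h2
    · exact absurd h1 h2.asymm
    · simp; ring
    · simp; ring
    · obtain rfl : i = j := le_antisymm (not_lt.mp h1) (not_lt.mp h2)
      simp
  · simpa [hv] using (Real.sqrt_pos.mpr (hz i)).ne'
  · rw [hAM, charpoly_of_isUpperTriangular]
    · refine Finset.prod_congr rfl fun i _ => ?_
      simp
    · intro i j hij
      have hij : j < i := hij
      simp [hij, hij.le]

/-- If `p - i α q` has its roots in the upper half plane then `p` and `q` interlace. -/
theorem interlaced_of_im_pos {n : ℕ} {p : Fin (n + 1) → ℝ} {q : Fin n → ℝ} {α : ℝ} (hα : 0 < α)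
    {z : Fin (n + 1) → ℂ} (hz : ∀ i, 0 < (z i).im)
    (h : (monicPoly p).map Complex.ofRealHom -
        C (Complex.I * α) * (monicPoly q).map Complex.ofRealHom = ∏ i, (X - C (z i))) :
    Interlaced n p q := by
  obtain ⟨A, v, hA, hv0, hAv⟩ := exists_charpoly_eq_prod z hz
  have hv : v ≠ 0 := fun h0 => hv0 0 (by simp [h0])
  rw [charpoly_add_smul, ← h] at hAv
  -- Both sides have the form (real) - i (real), so real and imaginary parts can be compared
  -- coefficientwise. The factor α is absorbed into |v|² = α, by the leading coefficient of q.
  have hre : ∀ k, A.charpoly.coeff k = ((monicPoly p).coeff k : ℂ) ∧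
      (resolventPoly A v).coeff k = α * ((monicPoly q).coeff k : ℂ) := by
    intro k
    have h1 := congrArg (fun P => P.coeff k) hAv
    simp only [coeff_sub, coeff_C_mul, coeff_map] at h1
    have h2 := IsHermitian.coeff_charpoly_im hA k
    have h3 := coeff_resolventPoly_im hA v k
    have h4 := congrArg Complex.re h1
    have h5 := congrArg Complex.im h1
    simp at h4 h5
    constructor
    · apply Complex.ext <;> simp <;> linarith
    · apply Complex.ext <;> simp <;> linarith
  have hsq : sqLength v = α := by
    have := (hre n).2
    rw [coeff_resolventPoly, dotProduct_star_eq, coeff_monicPoly_self] at this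
    simpa using this
  have hαC : (α : ℂ) ≠ 0 := by exact_mod_cast hα.ne'
  have hP : A.charpoly = (monicPoly p).map Complex.ofRealHom := by
    ext k; rw [(hre k).1]; simp
  have hQ : resolventPoly A (normalized v) = (monicPoly q).map Complex.ofRealHom := by
    have h1 := resolventPoly_eq_normalized A hv
    ext k
    have h2 := congrArg (fun P => P.coeff k) h1
    simp only [coeff_C_mul, (hre k).2, hsq] at h2
    rw [← mul_left_cancel₀ hαC h2]
    simp
  have hp : p = charCoeffs A := by
    ext i; rw [charCoeffs, hP]; simp
  have hq : q = resolventCoeffs A (normalized v) := by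
    ext i; rw [resolventCoeffs, hQ]; simp
  rw [hp, hq]
  refine interlaced_of_coprime hA (normalized_dotProduct hv) ?_
  rw [hP, hQ]
  rintro w ⟨hw1, hw2⟩
  -- A common root of the real polynomials p and q comes with its conjugate; both would be among the
  -- z_i, hence in the upper half plane.
  have hroot : ∀ u : ℂ, ((monicPoly p).map Complex.ofRealHom).IsRoot u →
      ((monicPoly q).map Complex.ofRealHom).IsRoot u → 0 < u.im := by
    intro u h1 h2
    have h3 : (∏ i, (X - C (z i))).eval u = 0 := by
      rw [← h, eval_sub, eval_mul, h1.eq_zero, h2.eq_zero]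
      simp
    rw [eval_prod, Finset.prod_eq_zero_iff] at h3
    obtain ⟨i, _, hi⟩ := h3
    have : u = z i := by simpa [sub_eq_zero] using hi
    rw [this]
    exact hz i
  have hconj : ∀ f : ℝ[X], (f.map Complex.ofRealHom).IsRoot w →
      (f.map Complex.ofRealHom).IsRoot (star w) := by
    intro f hf
    have h1 : aeval w f = 0 := by
      rwa [IsRoot.def, eval_map] at hf
    have h2 : aeval (star w) f = star (aeval w f) := aeval_conj f w
    rw [IsRoot.def, eval_map]
    change aeval (star w) f = 0
    rw [h2, h1, star_zero]
  have i1 := hroot w hw1 hw2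
  have i2 := hroot (star w) (hconj _ hw1) (hconj _ hw2)
  simp at i2
  linarith

end Interlacing

/-! ### Measure theory: maps of finite order, polar coordinates, splitting off a coordinate -/

section MeasureTools

open Set Module
open scoped ENNReal

variable {E : Type*} [NormedAddCommGroup E] [NormedSpace ℝ E] [MeasurableSpace E] [BorelSpace E]
  [FiniteDimensional ℝ E]

/-- An affine map of finite order preserves Lebesgue measure. -/
theorem measurePreserving_of_iterate_eq_id (μ : Measure E) [μ.IsAddHaarMeasure] {T : E → E}
    (L : E →ₗ[ℝ] E) (c : E) (hT : ∀ x, T x = L x + c) {k : ℕ} (hk : k ≠ 0) (h : T^[k] = id) :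
    MeasurePreserving T μ μ := by
  have h1 : ∀ j x y, T^[j] x - T^[j] y = (L ^ j) (x - y) := by
    intro j
    induction j with
    | zero => simp
    | succ j ih =>
      intro x y
      rw [Function.iterate_succ_apply', Function.iterate_succ_apply', hT, hT, pow_succ',
        Module.End.mul_apply, ← ih, map_sub]
      abel
  -- Finite order forces |det L| = 1, so no determinant has to be computed for reflections or
  -- permutations.
  have h2 : L ^ k = 1 := by
    ext x
    have := h1 k x 0
    rw [h] at this
    simpa using this.symm
  have h3 : |LinearMap.det L| = 1 := by
    have : |LinearMap.det L| ^ k = 1 := by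
      rw [← abs_pow, ← map_pow, h2, map_one, abs_one]
    exact (pow_eq_one_iff_of_nonneg (abs_nonneg _) hk).mp this
  have h4 : LinearMap.det L ≠ 0 := fun h0 => by simp [h0] at h3
  have hL : MeasurePreserving L μ μ := by
    refine ⟨L.continuous_of_finiteDimensional.measurable, ?_⟩
    rw [Measure.map_linearMap_addHaar_eq_smul_addHaar μ h4, abs_inv, h3]
    simp
  have : T = (fun x => x + c) ∘ L := by
    ext x; exact hT x
  rw [this]
  exact (measurePreserving_add_right μ c).comp hL

theorem lintegral_fun_norm_addHaar [Nontrivial E] (μ : Measure E) [μ.IsAddHaarMeasure]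
    {f : ℝ → ℝ≥0∞} (hf : Measurable f) :
    ∫⁻ x, f ‖x‖ ∂μ = μ.toSphere univ *
      ∫⁻ y in Ioi (0 : ℝ), ENNReal.ofReal (y ^ (finrank ℝ E - 1)) * f y :=
  calc
    ∫⁻ x, f ‖x‖ ∂μ = ∫⁻ x : ({(0)}ᶜ : Set E), f ‖x.1‖ ∂(μ.comap (↑)) := by
      rw [lintegral_subtype_comap (measurableSet_singleton _).compl fun x => f ‖x‖,
        restrict_compl_singleton]
    _ = ∫⁻ x, f x.2 ∂μ.toSphere.prod (.volumeIoiPow (finrank ℝ E - 1)) := by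
      simpa using μ.measurePreserving_homeomorphUnitSphereProd.lintegral_comp_emb
        (Homeomorph.measurableEmbedding _) (f ∘ Subtype.val ∘ Prod.snd)
    _ = μ.toSphere univ * ∫⁻ x : Ioi (0 : ℝ), f x ∂.volumeIoiPow (finrank ℝ E - 1) := by
      rw [lintegral_prod _ (by fun_prop)]
      simp [mul_comm]
    _ = _ := by
      congr 1
      rw [Measure.volumeIoiPow, lintegral_withDensity_eq_lintegral_mul₀ (by fun_prop) (by fun_prop)]
      exact lintegral_subtype_comap measurableSet_Ioi
        (fun y => ENNReal.ofReal (y ^ (finrank ℝ E - 1)) * f y)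

theorem lintegral_Ioi_sq {g : ℝ → ℝ≥0∞} :
    ∫⁻ y in Ioi (0 : ℝ), ENNReal.ofReal (2 * y) * g (y ^ 2) = ∫⁻ r in Ioi (0 : ℝ), g r := by
  have himg : (fun y : ℝ => y ^ 2) '' Ioi 0 = Ioi 0 := by
    ext r
    constructor
    · rintro ⟨y, hy, rfl⟩
      exact pow_pos (show 0 < y from hy) 2
    · intro hr
      exact ⟨Real.sqrt r, Real.sqrt_pos.mpr hr, Real.sq_sqrt (le_of_lt hr)⟩
  have hinj : InjOn (fun y : ℝ => y ^ 2) (Ioi 0) := by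
    intro x hx y hy hxy
    exact (pow_left_inj₀ (le_of_lt hx) (le_of_lt hy) two_ne_zero).mp hxy
  have h := lintegral_image_eq_lintegral_abs_deriv_mul measurableSet_Ioi
    (fun x _ => (hasDerivAt_pow 2 x).hasDerivWithinAt) hinj g
  rw [himg] at h
  rw [h]
  refine setLIntegral_congr_fun measurableSet_Ioi fun y hy => ?_
  have hy : 0 < y := hy
  simp [abs_of_pos hy]

/-- Integration of a function of the squared length over a complex Euclidean space. -/
theorem exists_lintegral_sqLength (n : ℕ) : ∃ κ : ℝ≥0∞, κ ≠ 0 ∧ κ ≠ ∞ ∧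
    ∀ g : ℝ → ℝ≥0∞, Measurable g → ∫⁻ b : Fin (n + 1) → ℂ, g (sqLength b) =
      κ * ∫⁻ r in Ioi (0 : ℝ), ENNReal.ofReal (r ^ n) * g r := by
  let e : (Fin (n + 1) → ℂ) ≃L[ℝ] EuclideanSpace ℂ (Fin (n + 1)) :=
    (PiLp.continuousLinearEquiv 2 ℝ fun _ : Fin (n + 1) => ℂ).symm
  let μ : Measure (EuclideanSpace ℂ (Fin (n + 1))) := Measure.map e volume
  have : μ.IsAddHaarMeasure := ContinuousLinearEquiv.isAddHaarMeasure_map e volume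
  -- The radial density is y^(2n+1), and the substitution r = y² turns it into r^n / 2.
  have hd : finrank ℝ (EuclideanSpace ℂ (Fin (n + 1))) - 1 = 2 * n + 1 := by
    rw [finrank_real_of_complex, finrank_euclideanSpace, Fintype.card_fin]
    omega
  refine ⟨μ.toSphere univ * 2⁻¹, ?_, ?_, fun g hg => ?_⟩
  · exact mul_ne_zero (Measure.measure_univ_ne_zero.mpr (Measure.toSphere_ne_zero μ)) (by simp)
  · exact ENNReal.mul_ne_top (measure_ne_top _ _) (by simp)
  have hsq : ∀ b : Fin (n + 1) → ℂ, sqLength b = ‖e b‖ ^ 2 := by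
    intro b
    rw [EuclideanSpace.norm_sq_eq]
    rfl
  have hg2 : Measurable fun y : ℝ => g (y ^ 2) := by fun_prop
  calc ∫⁻ b : Fin (n + 1) → ℂ, g (sqLength b) = ∫⁻ x, g (‖x‖ ^ 2) ∂μ := by
        rw [lintegral_map (by fun_prop) e.continuous.measurable]
        simp_rw [hsq]
    _ = μ.toSphere univ * ∫⁻ y in Ioi (0 : ℝ), ENNReal.ofReal (y ^ (2 * n + 1)) * g (y ^ 2) := by
        rw [lintegral_fun_norm_addHaar μ hg2, hd]
    _ = μ.toSphere univ * ∫⁻ y in Ioi (0 : ℝ), ENNReal.ofReal (2 * y) *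
          (2⁻¹ * (ENNReal.ofReal ((y ^ 2) ^ n) * g (y ^ 2))) := by
        congr 1
        refine setLIntegral_congr_fun measurableSet_Ioi fun y hy => ?_
        have hy : 0 < y := hy
        have h2 : (2⁻¹ : ℝ≥0∞) = ENNReal.ofReal 2⁻¹ := by
          rw [ENNReal.ofReal_inv_of_pos (by norm_num)]; simp
        simp only [h2, ← mul_assoc]
        rw [← ENNReal.ofReal_mul (by positivity), ← ENNReal.ofReal_mul (by positivity)]
        congr 2
        rw [← pow_mul, pow_succ]
        ring
    _ = _ := by
        rw [lintegral_Ioi_sq (g := fun r => 2⁻¹ * (ENNReal.ofReal (r ^ n) * g r)),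
          lintegral_const_mul _ (by fun_prop), mul_assoc]

theorem lintegral_comp_smul_pi {n : ℕ} {r : ℝ} (hr : 0 < r) {G : (Fin n → ℝ) → ℝ≥0∞}
    (hG : Measurable G) :
    ENNReal.ofReal (r ^ n) * ∫⁻ x, G (r • x) = ∫⁻ x, G x := by
  have h := Measure.map_addHaar_smul (volume : Measure (Fin n → ℝ)) hr.ne'
  rw [finrank_fin_fun, abs_inv, abs_of_pos (pow_pos hr n)] at h
  rw [← lintegral_map (f := G) hG (measurable_const_smul r), h, lintegral_smul_measure,
    smul_eq_mul, ← mul_assoc, ← ENNReal.ofReal_mul (by positivity),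
    mul_inv_cancel₀ (pow_pos hr n).ne']
  simp

theorem measurable_fin_cons {n : ℕ} {β : Type} [MeasurableSpace β] :
    Measurable fun p : β × (Fin n → β) => (Fin.cons p.1 p.2 : Fin (n + 1) → β) := by
  refine measurable_pi_lambda _ fun i => ?_
  refine Fin.cases ?_ (fun i => ?_) i
  · simpa using measurable_fst
  · simp only [Fin.cons_succ]; fun_prop

theorem measurable_fin_snoc {n : ℕ} {β : Type} [MeasurableSpace β] :
    Measurable fun p : (Fin n → β) × β => (Fin.snoc p.1 p.2 : Fin (n + 1) → β) := by
  refine measurable_pi_lambda _ fun i => ?_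
  refine Fin.lastCases ?_ (fun i => ?_) i
  · simpa using measurable_snd
  · simp only [Fin.snoc_castSucc]; fun_prop

theorem lintegral_fin_cons {n : ℕ} {β : Type} [MeasureSpace β] [SigmaFinite (volume : Measure β)]
    {G : (Fin (n + 1) → β) → ℝ≥0∞} (hG : Measurable G) :
    ∫⁻ x, G x = ∫⁻ a : β, ∫⁻ y : Fin n → β, G (Fin.cons a y) := by
  have h := (volume_preserving_piFinSuccAbove (fun _ : Fin (n + 1) => β) 0).symm
  have hm : Measurable fun p : β × (Fin n → β) => G (Fin.cons p.1 p.2) :=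
    hG.comp measurable_fin_cons
  rw [← h.lintegral_comp hG]
  refine Eq.trans ?_ (lintegral_prod _ hm.aemeasurable)
  simp [MeasurableEquiv.piFinSuccAbove]
  rfl

theorem lintegral_fin_snoc {n : ℕ} {β : Type} [MeasureSpace β] [SigmaFinite (volume : Measure β)]
    {G : (Fin (n + 1) → β) → ℝ≥0∞} (hG : Measurable G) :
    ∫⁻ x, G x = ∫⁻ a : β, ∫⁻ y : Fin n → β, G (Fin.snoc y a) := by
  have h := (volume_preserving_piFinSuccAbove (fun _ : Fin (n + 1) => β) (Fin.last n)).symm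
  have hm : Measurable fun p : β × (Fin n → β) => G (Fin.snoc p.2 p.1) :=
    hG.comp (measurable_fin_snoc.comp measurable_swap)
  rw [← h.lintegral_comp hG]
  refine Eq.trans ?_ (lintegral_prod _ hm.aemeasurable)
  simp [MeasurableEquiv.piFinSuccAbove, Fin.insertNthEquiv]
  rfl

end MeasureTools

/-! ### Lebesgue measure on Hermitian matrices: conjugation and bordering -/

section Entries

open Set Module Matrix
open scoped ENNReal

theorem isHermitian_hermitianOfEntries {N : ℕ} (h : HermitianEntries N) :
    (hermitianOfEntries N h).IsHermitian := by
  ext i j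
  rw [conjTranspose_apply]
  simp only [hermitianOfEntries, of_apply]
  split_ifs with h1 h2 h2
  · exact absurd h1 h2.asymm
  · rfl
  · exact star_star _
  · obtain rfl : i = j := le_antisymm (not_lt.mp h1) (not_lt.mp h2)
    exact Complex.conj_ofReal _

/-- The independent entries of a matrix. -/
def entriesOf {N : ℕ} (A : Matrix (Fin N) (Fin N) ℂ) : HermitianEntries N :=
  (fun i => (A i i).re, fun p => A p.1.1 p.1.2)

theorem entriesOf_hermitianOfEntries {N : ℕ} (h : HermitianEntries N) :
    entriesOf (hermitianOfEntries N h) = h := by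
  refine Prod.ext (funext fun i => ?_) (funext fun p => ?_)
  · simp [entriesOf, hermitianOfEntries]
  · simp [entriesOf, hermitianOfEntries, p.2]

theorem hermitianOfEntries_entriesOf {N : ℕ} {A : Matrix (Fin N) (Fin N) ℂ}
    (hA : A.IsHermitian) : hermitianOfEntries N (entriesOf A) = A := by
  ext i j
  simp only [hermitianOfEntries, entriesOf, of_apply]
  split_ifs with h1 h2
  · rfl
  · exact hA.apply i j
  · obtain rfl : i = j := le_antisymm (not_lt.mp h2) (not_lt.mp h1)
    exact hA.coe_re_apply_self i

theorem continuous_hermitianOfEntries (N : ℕ) : Continuous (hermitianOfEntries N) := by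
  refine continuous_pi fun i => continuous_pi fun j => ?_
  simp only [hermitianOfEntries, of_apply]
  split_ifs <;> fun_prop

theorem hermitianOfEntries_add {N : ℕ} (h h' : HermitianEntries N) :
    hermitianOfEntries N (h + h') = hermitianOfEntries N h + hermitianOfEntries N h' := by
  ext i j
  simp only [hermitianOfEntries, of_apply, Matrix.add_apply]
  split_ifs <;> simp

theorem hermitianOfEntries_smul {N : ℕ} (c : ℝ) (h : HermitianEntries N) :
    hermitianOfEntries N (c • h) = (c : ℂ) • hermitianOfEntries N h := by
  ext i j
  simp only [hermitianOfEntries, of_apply, Matrix.smul_apply]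
  split_ifs <;> simp

/-- The action on the independent entries of the conjugation by `U`. -/
noncomputable def conjEntries {N : ℕ} (U : Matrix (Fin N) (Fin N) ℂ) :
    HermitianEntries N →ₗ[ℝ] HermitianEntries N where
  toFun h := entriesOf (U * hermitianOfEntries N h * U)
  map_add' h h' := by
    rw [hermitianOfEntries_add, Matrix.mul_add, Matrix.add_mul]
    refine Prod.ext (funext fun i => ?_) (funext fun p => ?_) <;> simp [entriesOf]
  map_smul' c h := by
    rw [hermitianOfEntries_smul, Matrix.mul_smul, Matrix.smul_mul]
    refine Prod.ext (funext fun i => ?_) (funext fun p => ?_) <;> simp [entriesOf]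

theorem hermitianOfEntries_conjEntries {N : ℕ} {U : Matrix (Fin N) (Fin N) ℂ}
    (hU : U.IsHermitian) (h : HermitianEntries N) :
    hermitianOfEntries N (conjEntries U h) = U * hermitianOfEntries N h * U :=
  hermitianOfEntries_entriesOf (isHermitian_conj hU (isHermitian_hermitianOfEntries h))

/-- The conjugation by a reflection preserves Lebesgue measure on Hermitian matrices. -/
theorem measurePreserving_conjEntries {N : ℕ} {U : Matrix (Fin N) (Fin N) ℂ}
    (hU : U * U = 1) (hH : U.IsHermitian) :
    MeasurePreserving (conjEntries U) (volume : Measure (HermitianEntries N)) volume := by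
  have : (volume : Measure (HermitianEntries N)).IsAddHaarMeasure :=
    Measure.prod.instIsAddHaarMeasure volume volume
  -- Conjugation by U is an involution because U² = 1.
  refine measurePreserving_of_iterate_eq_id volume (conjEntries U) 0 (fun x => by simp)
    two_ne_zero ?_
  ext1 h
  have h2 : conjEntries U (conjEntries U h) = entriesOf (U * (U * hermitianOfEntries N h * U) * U) := by
    rw [← hermitianOfEntries_conjEntries hH]
    rfl
  have h3 : U * (U * hermitianOfEntries N h * U) * U = hermitianOfEntries N h := by
    rw [← Matrix.mul_assoc, ← Matrix.mul_assoc, hU, Matrix.one_mul, Matrix.mul_assoc, hU,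
      Matrix.mul_one]
  change conjEntries U (conjEntries U h) = h
  rw [h2, h3, entriesOf_hermitianOfEntries]

/-- The pairs `i < j` in `Fin (m + 1)`, split according to whether `i = 0`. -/
def pairsSucc (m : ℕ) : Fin m ⊕ {p : Fin m × Fin m // p.1 < p.2} ≃
    {p : Fin (m + 1) × Fin (m + 1) // p.1 < p.2} where
  toFun := Sum.elim (fun j => ⟨(0, j.succ), Fin.succ_pos j⟩)
    (fun p => ⟨(p.1.1.succ, p.1.2.succ), Fin.succ_lt_succ_iff.mpr p.2⟩)
  invFun p := if h : p.1.1 = 0 then Sum.inl (p.1.2.pred (Fin.pos_of_ne_zero (fun h' => by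
      have := p.2; rw [h'] at this; exact absurd this (Fin.not_lt_zero _)) |>.ne'))
    else Sum.inr ⟨(p.1.1.pred h, p.1.2.pred (Fin.pos_of_ne_zero (fun h' => by
      have := p.2; rw [h'] at this; exact absurd this (Fin.not_lt_zero _)) |>.ne')), by
        simpa using p.2⟩
  left_inv x := by
    rcases x with j | p <;> simp
  right_inv p := by
    by_cases h : p.1.1 = 0
    · simp [h, Subtype.ext_iff, Prod.ext_iff]
    · simp [h]

/-- The independent entries of the Hermitian matrix with blocks `a`, `b`, `b†` and `h`. -/
def borderEntries {m : ℕ} (a : ℝ) (b : Fin m → ℂ) (h : HermitianEntries m) :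
    HermitianEntries (m + 1) :=
  (Fin.cons a h.1, fun p => Sum.elim (fun j => star (b j)) h.2 ((pairsSucc m).symm p))

theorem borderEntries_apply_zero {m : ℕ} (a : ℝ) (b : Fin m → ℂ) (h : HermitianEntries m) :
    hermitianOfEntries (m + 1) (borderEntries a b h) 0 0 = a := by
  simp [hermitianOfEntries, borderEntries]

theorem borderEntries_apply_succ_zero {m : ℕ} (a : ℝ) (b : Fin m → ℂ) (h : HermitianEntries m)
    (i : Fin m) : hermitianOfEntries (m + 1) (borderEntries a b h) i.succ 0 = b i := by
  have h2 : (pairsSucc m).symm ⟨(0, i.succ), Fin.succ_pos i⟩ = Sum.inl i :=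
    (Equiv.symm_apply_eq _).mpr rfl
  simp [hermitianOfEntries, borderEntries, h2]

theorem borderEntries_submatrix {m : ℕ} (a : ℝ) (b : Fin m → ℂ) (h : HermitianEntries m) :
    (hermitianOfEntries (m + 1) (borderEntries a b h)).submatrix Fin.succ Fin.succ =
      hermitianOfEntries m h := by
  have h2 : ∀ (i j : Fin m) (hij : i < j), (pairsSucc m).symm
      ⟨(i.succ, j.succ), Fin.succ_lt_succ_iff.mpr hij⟩ = Sum.inr ⟨(i, j), hij⟩ :=
    fun i j hij => (Equiv.symm_apply_eq _).mpr rfl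
  ext i j
  simp only [submatrix_apply, hermitianOfEntries, borderEntries, of_apply, Fin.succ_lt_succ_iff]
  split_ifs with h3 h4
  · rw [h2 _ _ h3]; rfl
  · rw [h2 _ _ h4]; rfl
  · rfl

/-- The border b is the first column, whereas the independent entries lie above the diagonal; this
conjugation must not affect the measure. -/
theorem measurePreserving_star_pi (m : ℕ) :
    MeasurePreserving (fun b : Fin m → ℂ => fun j => star (b j)) volume volume := by
  refine volume_preserving_pi fun _ => ?_
  exact Complex.conjLIE.measurePreserving

theorem measurable_borderEntries (m : ℕ) :
    Measurable fun x : ℝ × (Fin m → ℂ) × HermitianEntries m => borderEntries x.1 x.2.1 x.2.2 := by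
  refine Measurable.prodMk ?_ (measurable_pi_lambda _ fun p => ?_)
  · exact measurable_fin_cons.comp (measurable_fst.prodMk (by fun_prop))
  · rcases (pairsSucc m).symm p with j | p
    · simp only [Sum.elim_inl]; fun_prop
    · simp only [Sum.elim_inr]; fun_prop

theorem measurePreserving_pairs (m : ℕ) :
    MeasurePreserving (fun (x : (Fin m → ℂ) × ({p : Fin m × Fin m // p.1 < p.2} → ℂ)) p =>
      Sum.elim (fun j => star (x.1 j)) x.2 ((pairsSucc m).symm p)) volume volume := by
  have h1 : MeasurePreserving (Prod.map (fun (b : Fin m → ℂ) j => star (b j))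
      (id : ({p : Fin m × Fin m // p.1 < p.2} → ℂ) → _)) volume volume :=
    (measurePreserving_star_pi m).prod (MeasurePreserving.id _)
  have h2 := volume_measurePreserving_sumPiEquivProdPi_symm
    (fun _ : Fin m ⊕ {p : Fin m × Fin m // p.1 < p.2} => ℂ)
  have h3 := volume_measurePreserving_piCongrLeft (fun _ => ℂ) (pairsSucc m)
  convert! h3.comp (h2.comp h1) using 1
  ext x p
  obtain ⟨q, rfl⟩ := (pairsSucc m).surjective p
  simp only [Equiv.symm_apply_apply, Function.comp_apply, MeasurableEquiv.coe_piCongrLeft,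
    Equiv.piCongrLeft_apply_apply]
  rcases q with j | q <;> rfl

/-- The entries of the corner, the border and the block are disjoint sets of independent
coordinates, so this is Tonelli. It supplies the induction on the size of the matrix. -/
theorem lintegral_borderEntries {m : ℕ} {G : HermitianEntries (m + 1) → ℝ≥0∞}
    (hG : Measurable G) :
    ∫⁻ h, G h = ∫⁻ a : ℝ, ∫⁻ b : Fin m → ℂ, ∫⁻ h : HermitianEntries m,
      G (borderEntries a b h) := by
  have hG' : Measurable fun x : ℝ × (Fin m → ℂ) × HermitianEntries m =>
    G (borderEntries x.1 x.2.1 x.2.2) := hG.comp (measurable_borderEntries m)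
  calc ∫⁻ h, G h = ∫⁻ d : Fin (m + 1) → ℝ, ∫⁻ c, G (d, c) :=
        lintegral_prod _ hG.aemeasurable
    _ = ∫⁻ d : Fin (m + 1) → ℝ, ∫⁻ x : (Fin m → ℂ) × ({p : Fin m × Fin m // p.1 < p.2} → ℂ),
          G (d, fun p => Sum.elim (fun j => star (x.1 j)) x.2 ((pairsSucc m).symm p)) := by
        refine lintegral_congr fun d => ?_
        exact ((measurePreserving_pairs m).lintegral_comp
          (hG.comp measurable_prodMk_left)).symm
    _ = ∫⁻ a : ℝ, ∫⁻ d : Fin m → ℝ,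
          ∫⁻ x : (Fin m → ℂ) × ({p : Fin m × Fin m // p.1 < p.2} → ℂ),
          G (borderEntries a x.1 (d, x.2)) := by
        rw [lintegral_fin_cons]
        · rfl
        · refine Measurable.lintegral_prod_right' (f := fun y : (Fin (m + 1) → ℝ) ×
            ((Fin m → ℂ) × ({p : Fin m × Fin m // p.1 < p.2} → ℂ)) => G (y.1, fun p =>
              Sum.elim (fun j => star (y.2.1 j)) y.2.2 ((pairsSucc m).symm p))) ?_
          exact hG.comp (measurable_fst.prodMk
            ((measurePreserving_pairs m).measurable.comp measurable_snd))
    _ = ∫⁻ a : ℝ, ∫⁻ d : Fin m → ℝ, ∫⁻ b : Fin m → ℂ, ∫⁻ c,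
          G (borderEntries a b (d, c)) := by
        refine lintegral_congr fun a => lintegral_congr fun d => ?_
        refine lintegral_prod _ (Measurable.aemeasurable ?_)
        exact hG'.comp (f := fun x : (Fin m → ℂ) × ({p : Fin m × Fin m // p.1 < p.2} → ℂ) =>
          (a, x.1, (d, x.2))) (by fun_prop)
    _ = ∫⁻ a : ℝ, ∫⁻ b : Fin m → ℂ, ∫⁻ d : Fin m → ℝ, ∫⁻ c,
          G (borderEntries a b (d, c)) := by
        refine lintegral_congr fun a => ?_
        refine lintegral_lintegral_swap (Measurable.aemeasurable ?_)
        refine Measurable.lintegral_prod_right' (f := fun y : ((Fin m → ℝ) × (Fin m → ℂ)) ×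
          ({p : Fin m × Fin m // p.1 < p.2} → ℂ) => G (borderEntries a y.1.2 (y.1.1, y.2))) ?_
        exact hG'.comp (f := fun y : ((Fin m → ℝ) × (Fin m → ℂ)) ×
          ({p : Fin m × Fin m // p.1 < p.2} → ℂ) => (a, y.1.2, (y.1.1, y.2))) (by fun_prop)
    _ = _ := by
        refine lintegral_congr fun a => lintegral_congr fun b => ?_
        refine (lintegral_prod (fun x : HermitianEntries m => G (borderEntries a b x))
          (Measurable.aemeasurable ?_)).symm
        exact hG'.comp (f := fun x : HermitianEntries m => (a, b, x)) (by fun_prop)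

end Entries

/-! ### The law of the pair (p, q) under Lebesgue measure -/

section Law

open Set Polynomial
open scoped ENNReal

theorem measurable_coeff_monicPoly (n k : ℕ) :
    Measurable fun c : Fin n → ℝ => (monicPoly c).coeff k := by
  simp only [coeff_monicPoly]
  split_ifs <;> fun_prop

theorem coeff_X_sub_C_mul (a : ℝ) (P : ℝ[X]) (k : ℕ) :
    ((X - C a) * P).coeff k = (X * P).coeff k - a * P.coeff k := by
  rw [sub_mul, coeff_sub, coeff_C_mul]

theorem measurable_coeff_X_mul_monicPoly (n k : ℕ) :
    Measurable fun c : Fin n → ℝ => (X * monicPoly c : ℝ[X]).coeff k := by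
  cases k with
  | zero => simp
  | succ k =>
    simp only [coeff_X_mul]
    exact measurable_coeff_monicPoly n k

theorem measurable_coeff_negRemainder (n k : ℕ) :
    Measurable fun x : (Fin (n + 2) → ℝ) × (Fin (n + 1) → ℝ) =>
      (negRemainder x.1 x.2).coeff k := by
  have h1 := (measurable_coeff_X_mul_monicPoly (n + 1) k).comp
    (f := fun x : (Fin (n + 2) → ℝ) × (Fin (n + 1) → ℝ) => x.2) (by fun_prop)
  have h2 := (measurable_coeff_monicPoly (n + 1) k).comp
    (f := fun x : (Fin (n + 2) → ℝ) × (Fin (n + 1) → ℝ) => x.2) (by fun_prop)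
  have h3 := (measurable_coeff_monicPoly (n + 2) k).comp
    (f := fun x : (Fin (n + 2) → ℝ) × (Fin (n + 1) → ℝ) => x.1) (by fun_prop)
  simp only [negRemainder, coeff_sub, coeff_X_sub_C_mul, quotientShift]
  exact (h1.sub (Measurable.mul (by fun_prop) h2)).sub h3

theorem measurableSet_interlaced (n : ℕ) :
    MeasurableSet {x : (Fin (n + 1) → ℝ) × (Fin n → ℝ) | Interlaced n x.1 x.2} := by
  induction n with
  | zero => exact MeasurableSet.univ
  | succ n ih =>
    refine (measurableSet_lt measurable_const (measurable_coeff_negRemainder n n)).inter ?_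
    refine ih.preimage (f := fun x : (Fin (n + 2) → ℝ) × (Fin (n + 1) → ℝ) =>
      (x.2, fun i : Fin n => (negRemainder x.1 x.2).coeff i / (negRemainder x.1 x.2).coeff n)) ?_
    refine measurable_snd.prodMk (measurable_pi_lambda _ fun i => ?_)
    exact (measurable_coeff_negRemainder n i).div (measurable_coeff_negRemainder n n)

theorem measurable_euclidStep (n : ℕ) :
    Measurable fun x : (Fin (n + 1) → ℝ) × ℝ × ℝ × (Fin n → ℝ) =>
      euclidStep x.2.1 x.1 (C x.2.2.1 * monicPoly x.2.2.2) := by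
  refine measurable_pi_lambda _ fun i => ?_
  simp only [euclidStep, coeff_sub, coeff_X_sub_C_mul, coeff_C_mul]
  have h1 := (measurable_coeff_X_mul_monicPoly (n + 1) i).comp
    (f := fun x : (Fin (n + 1) → ℝ) × ℝ × ℝ × (Fin n → ℝ) => x.1) (by fun_prop)
  have h2 := (measurable_coeff_monicPoly (n + 1) i).comp
    (f := fun x : (Fin (n + 1) → ℝ) × ℝ × ℝ × (Fin n → ℝ) => x.1) (by fun_prop)
  have h3 := (measurable_coeff_monicPoly n i).comp
    (f := fun x : (Fin (n + 1) → ℝ) × ℝ × ℝ × (Fin n → ℝ) => x.2.2.2) (by fun_prop)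
  exact (h1.sub (Measurable.mul (by fun_prop) h2)).sub (Measurable.mul (by fun_prop) h3)

/-- The polynomial of degree at most `n` with the given coefficients. -/
noncomputable def polyOfCoeffs {n : ℕ} (s : Fin (n + 1) → ℝ) : ℝ[X] :=
  ∑ i : Fin (n + 1), C (s i) * X ^ (i : ℕ)

theorem coeff_polyOfCoeffs {n : ℕ} (s : Fin (n + 1) → ℝ) (k : ℕ) :
    (polyOfCoeffs s).coeff k = if h : k < n + 1 then s ⟨k, h⟩ else 0 := by
  have h := coeff_monicPoly s k
  rw [monicPoly, coeff_add, coeff_X_pow] at h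
  rw [polyOfCoeffs]
  split_ifs at h ⊢ <;> first | omega | linarith

theorem polyOfCoeffs_snoc {n : ℕ} (r : ℝ) (q : Fin n → ℝ) :
    polyOfCoeffs (Fin.snoc (r • q) r) = C r * monicPoly q := by
  rw [polyOfCoeffs, Fin.sum_univ_castSucc]
  simp [monicPoly, mul_add, Finset.mul_sum, mul_assoc, add_comm]

theorem euclidStep_polyOfCoeffs {n : ℕ} (a : ℝ) (q s : Fin (n + 1) → ℝ) :
    euclidStep a q (polyOfCoeffs s) =
      Fin.snoc (fun i : Fin (n + 1) => ((X - C a) * monicPoly q).coeff i - s i)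
        (q (Fin.last n) - a) := by
  ext i
  refine Fin.lastCases ?_ (fun i => ?_) i
  · have := coeff_monicPoly_fin q (Fin.last n)
    rw [Fin.val_last] at this
    rw [Fin.snoc_last, euclidStep, coeff_sub, coeff_polyOfCoeffs, coeff_X_sub_C_mul, Fin.val_last,
      coeff_X_mul, this, coeff_monicPoly_self]
    simp
  · rw [Fin.snoc_castSucc, euclidStep, coeff_sub, coeff_polyOfCoeffs, Fin.val_castSucc, dif_pos i.2]

/-- For fixed q, the top coefficient of p is a translate of -a, and the lower ones are a translate
of -s, with s the coefficients of r q'. Since s = (r q', r), passing from s to (r, q') costs r^n.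
The hypothesis `hJ0` discards r ≤ 0, which this parametrisation misses. -/
theorem lintegral_euclidStep {n : ℕ} (q : Fin (n + 1) → ℝ) {J : (Fin (n + 2) → ℝ) → ℝ≥0∞}
    (hJ : Measurable J) (hJ0 : ∀ p, (negRemainder p q).coeff n ≤ 0 → J p = 0) :
    ∫⁻ p, J p = ∫⁻ a : ℝ, ∫⁻ r in Ioi (0 : ℝ), ENNReal.ofReal (r ^ n) *
      ∫⁻ q' : Fin n → ℝ, J (euclidStep a q (C r * monicPoly q')) := by
  have hsub : ∀ a : ℝ, Measurable fun s : Fin (n + 1) → ℝ =>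
      J (euclidStep a q (polyOfCoeffs s)) := by
    intro a
    simp only [euclidStep_polyOfCoeffs]
    have h : Measurable fun s : Fin (n + 1) → ℝ =>
        ((fun i : Fin (n + 1) => ((X - C a) * monicPoly q).coeff i - s i), q (Fin.last n) - a) :=
      Measurable.prodMk
        (measurable_pi_lambda _ fun i => measurable_const.sub (measurable_pi_apply i))
        measurable_const
    exact hJ.comp (measurable_fin_snoc.comp h)
  have hinner : ∀ a : ℝ, ∫⁻ r in Ioi (0 : ℝ), ENNReal.ofReal (r ^ n) *
      ∫⁻ q' : Fin n → ℝ, J (euclidStep a q (C r * monicPoly q')) =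
      ∫⁻ t : Fin (n + 1) → ℝ, J (Fin.snoc t (q (Fin.last n) - a)) := by
    intro a
    calc ∫⁻ r in Ioi (0 : ℝ), ENNReal.ofReal (r ^ n) *
          ∫⁻ q' : Fin n → ℝ, J (euclidStep a q (C r * monicPoly q'))
        = ∫⁻ r in Ioi (0 : ℝ), ∫⁻ w : Fin n → ℝ,
            J (euclidStep a q (polyOfCoeffs (Fin.snoc w r))) := by
          refine setLIntegral_congr_fun measurableSet_Ioi fun r hr => ?_
          simp only [← polyOfCoeffs_snoc]
          exact lintegral_comp_smul_pi hr (G := fun w =>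
            J (euclidStep a q (polyOfCoeffs (Fin.snoc w r))))
            ((hsub a).comp (measurable_fin_snoc.comp
              (Measurable.prodMk measurable_id measurable_const)))
      -- The leading coefficient of the negated remainder is r, so `hJ0` makes the added half line
      -- contribute nothing.
      _ = ∫⁻ r : ℝ, ∫⁻ w : Fin n → ℝ, J (euclidStep a q (polyOfCoeffs (Fin.snoc w r))) := by
          refine setLIntegral_eq_of_support_subset ?_
          intro r hr
          by_contra hr0
          refine hr ?_
          refine (lintegral_congr fun w => hJ0 _ ?_).trans lintegral_zero
          rw [negRemainder_euclidStep, coeff_polyOfCoeffs, dif_pos (Nat.lt_succ_self n)]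
          · have : (⟨n, Nat.lt_succ_self n⟩ : Fin (n + 1)) = Fin.last n := rfl
            rw [this, Fin.snoc_last]
            exact not_lt.mp hr0
          · intro k hk
            rw [coeff_polyOfCoeffs, dif_neg (by omega)]
      _ = ∫⁻ s : Fin (n + 1) → ℝ, J (euclidStep a q (polyOfCoeffs s)) :=
          (lintegral_fin_snoc (hsub a)).symm
      _ = _ := by
          simp only [euclidStep_polyOfCoeffs]
          have h := lintegral_sub_left_eq_self (μ := (volume : Measure (Fin (n + 1) → ℝ)))
            (fun t : Fin (n + 1) → ℝ => J (Fin.snoc t (q (Fin.last n) - a)))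
            (fun i : Fin (n + 1) => ((X - C a) * monicPoly q).coeff i)
          exact h
  simp only [hinner]
  rw [lintegral_fin_snoc hJ]
  exact (lintegral_sub_left_eq_self
    (fun a : ℝ => ∫⁻ t : Fin (n + 1) → ℝ, J (Fin.snoc t a)) (q (Fin.last n))).symm

/-- Integration over interlacing pairs in the coordinates of one Euclidean step. -/
theorem lintegral_interlaced_succ {n : ℕ} {F : (Fin (n + 2) → ℝ) × (Fin (n + 1) → ℝ) → ℝ≥0∞}
    (hF : Measurable F) :
    ∫⁻ x in {x | Interlaced (n + 1) x.1 x.2}, F x =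
      ∫⁻ a : ℝ, ∫⁻ r in Ioi (0 : ℝ), ENNReal.ofReal (r ^ n) *
        ∫⁻ x in {x : (Fin (n + 1) → ℝ) × (Fin n → ℝ) | Interlaced n x.1 x.2},
          F (euclidStep a x.1 (C r * monicPoly x.2), x.1) := by
  set J := {x : (Fin (n + 2) → ℝ) × (Fin (n + 1) → ℝ) | Interlaced (n + 1) x.1 x.2}.indicator F
    with hJdef
  have hJ : Measurable J := hF.indicator (measurableSet_interlaced (n + 1))
  have hΦ : Measurable fun x : (Fin (n + 1) → ℝ) × ℝ × ℝ × (Fin n → ℝ) =>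
      J (euclidStep x.2.1 x.1 (C x.2.2.1 * monicPoly x.2.2.2), x.1) :=
    hJ.comp ((measurable_euclidStep n).prodMk measurable_fst)
  have hΦ1 : Measurable fun x : ((Fin (n + 1) → ℝ) × ℝ) × ℝ =>
      ENNReal.ofReal (x.2 ^ n) * ∫⁻ q' : Fin n → ℝ,
        J (euclidStep x.1.2 x.1.1 (C x.2 * monicPoly q'), x.1.1) := by
    refine Measurable.mul (by fun_prop) ?_
    refine Measurable.lintegral_prod_right' (f := fun y : (((Fin (n + 1) → ℝ) × ℝ) × ℝ) ×
      (Fin n → ℝ) => J (euclidStep y.1.1.2 y.1.1.1 (C y.1.2 * monicPoly y.2), y.1.1.1)) ?_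
    exact hΦ.comp (f := fun y : (((Fin (n + 1) → ℝ) × ℝ) × ℝ) × (Fin n → ℝ) =>
      (y.1.1.1, y.1.1.2, y.1.2, y.2)) (by fun_prop)
  calc ∫⁻ x in {x | Interlaced (n + 1) x.1 x.2}, F x = ∫⁻ x, J x :=
        (lintegral_indicator (measurableSet_interlaced (n + 1)) F).symm
    _ = ∫⁻ q, ∫⁻ p, J (p, q) := lintegral_prod_symm _ hJ.aemeasurable
    _ = ∫⁻ q, ∫⁻ a : ℝ, ∫⁻ r in Ioi (0 : ℝ), ENNReal.ofReal (r ^ n) *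
          ∫⁻ q' : Fin n → ℝ, J (euclidStep a q (C r * monicPoly q'), q) := by
        refine lintegral_congr fun q => ?_
        refine lintegral_euclidStep q (J := fun p => J (p, q))
          (hJ.comp measurable_prodMk_right) fun p hp => ?_
        refine indicator_of_notMem (fun hmem => ?_) F
        exact absurd hmem.1 (not_lt.mpr hp)
    _ = ∫⁻ a : ℝ, ∫⁻ q, ∫⁻ r in Ioi (0 : ℝ), ENNReal.ofReal (r ^ n) *
          ∫⁻ q' : Fin n → ℝ, J (euclidStep a q (C r * monicPoly q'), q) :=
        lintegral_lintegral_swap (Measurable.aemeasurable (Measurable.lintegral_prod_right' hΦ1))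
    _ = ∫⁻ a : ℝ, ∫⁻ r in Ioi (0 : ℝ), ∫⁻ q, ENNReal.ofReal (r ^ n) *
          ∫⁻ q' : Fin n → ℝ, J (euclidStep a q (C r * monicPoly q'), q) := by
        refine lintegral_congr fun a => lintegral_lintegral_swap (Measurable.aemeasurable ?_)
        exact hΦ1.comp (f := fun x : (Fin (n + 1) → ℝ) × ℝ => ((x.1, a), x.2)) (by fun_prop)
    _ = _ := by
        refine lintegral_congr fun a => setLIntegral_congr_fun measurableSet_Ioi fun r hr => ?_
        have hm : Measurable fun x : (Fin (n + 1) → ℝ) × (Fin n → ℝ) =>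
            J (euclidStep a x.1 (C r * monicPoly x.2), x.1) :=
          hΦ.comp (f := fun x : (Fin (n + 1) → ℝ) × (Fin n → ℝ) => (x.1, a, r, x.2)) (by fun_prop)
        rw [lintegral_const_mul]
        · congr 1
          rw [← lintegral_indicator (measurableSet_interlaced n)]
          refine (lintegral_prod _ hm.aemeasurable).symm.trans (lintegral_congr fun x => ?_)
          have hr : 0 < r := hr
          have h := interlaced_euclidStep (a := a) (q := x.1) r x.2
          simp only [hr, true_and] at h
          have h' : (euclidStep a x.1 (C r * monicPoly x.2), x.1) ∈
              {x : (Fin (n + 2) → ℝ) × (Fin (n + 1) → ℝ) | Interlaced (n + 1) x.1 x.2} ↔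
              x ∈ {x : (Fin (n + 1) → ℝ) × (Fin n → ℝ) | Interlaced n x.1 x.2} := h
          by_cases hI : x ∈ {x : (Fin (n + 1) → ℝ) × (Fin n → ℝ) | Interlaced n x.1 x.2}
          · rw [hJdef, indicator_of_mem (h'.mpr hI), indicator_of_mem hI]
          · rw [hJdef, indicator_of_notMem (mt h'.mp hI), indicator_of_notMem hI]
        · exact Measurable.lintegral_prod_right' hm

/-- Each coefficient is a polynomial in the entries, by the universal characteristic polynomial. -/
theorem continuous_coeff_charpoly {m : Type*} [Fintype m] [DecidableEq m] (k : ℕ) :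
    Continuous fun A : Matrix m m ℂ => A.charpoly.coeff k := by
  have h : (fun A : Matrix m m ℂ => A.charpoly.coeff k) = fun A =>
      MvPolynomial.eval (fun p : m × m => A p.1 p.2) ((Matrix.charpoly.univ ℂ m).coeff k) := by
    ext A
    exact (Matrix.charpoly.univ_coeff_eval₂Hom m (RingHom.id ℂ)
      (fun p : m × m => A p.1 p.2) k).symm
  rw [h]
  exact (MvPolynomial.continuous_eval _).comp (by fun_prop)

theorem continuous_charCoeffs (n : ℕ) :
    Continuous (charCoeffs : Matrix (Fin n) (Fin n) ℂ → Fin n → ℝ) :=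
  continuous_pi fun _ => Complex.continuous_re.comp (continuous_coeff_charpoly _)

theorem continuous_resolventCoeffs {n : ℕ} (v : Fin (n + 1) → ℂ) :
    Continuous fun A : Matrix (Fin (n + 1)) (Fin (n + 1)) ℂ => resolventCoeffs A v := by
  refine continuous_pi fun i => Complex.continuous_re.comp ?_
  simp only [resolventPoly, coeff_sub]
  exact (continuous_coeff_charpoly _).sub ((continuous_coeff_charpoly _).comp (by fun_prop))

theorem measurable_charCoeffs_resolventCoeffs {n : ℕ} (v : Fin (n + 1) → ℂ) :
    Measurable fun h : HermitianEntries (n + 1) =>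
      (charCoeffs (hermitianOfEntries _ h), resolventCoeffs (hermitianOfEntries _ h) v) :=
  (((continuous_charCoeffs _).comp (continuous_hermitianOfEntries _)).prodMk
    ((continuous_resolventCoeffs v).comp (continuous_hermitianOfEntries _))).measurable

/-- The joint law of the coefficients of the characteristic polynomial and of `resolventPoly` is
independent of the direction. -/
theorem lintegral_resolventCoeffs_eq_single {n : ℕ}
    {F : (Fin (n + 1) → ℝ) × (Fin n → ℝ) → ℝ≥0∞} (hF : Measurable F) {v : Fin (n + 1) → ℂ}
    (hv : v ⬝ᵥ star v = 1) :
    ∫⁻ h, F (charCoeffs (hermitianOfEntries _ h), resolventCoeffs (hermitianOfEntries _ h) v) =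
      ∫⁻ h, F (charCoeffs (hermitianOfEntries _ h),
        charCoeffs ((hermitianOfEntries _ h).submatrix Fin.succ Fin.succ)) := by
  obtain ⟨U, hU, hH, hs⟩ := exists_reflection_resolventPoly v hv
  simp only [← resolventCoeffs_single]
  refine Eq.trans ?_ ((measurePreserving_conjEntries hU hH).lintegral_comp
    (hF.comp (measurable_charCoeffs_resolventCoeffs (Pi.single 0 1))))
  refine lintegral_congr fun h => ?_
  simp only [hermitianOfEntries_conjEntries hH]
  congr 2
  · ext i
    rw [charCoeffs, charCoeffs, charpoly_conj hU]
  · ext i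
    rw [resolventCoeffs, resolventCoeffs, hs]

theorem lintegral_pi_empty {ι : Type*} [Fintype ι] [IsEmpty ι] {β : Type*} [MeasureSpace β]
    [SigmaFinite (volume : Measure β)] (c : ℝ≥0∞) : ∫⁻ _ : ι → β, c = c := by
  rw [lintegral_const, volume_pi, Measure.pi_of_empty]
  simp

theorem charCoeffs_borderEntries {n : ℕ} (a : ℝ) {b : Fin (n + 1) → ℂ} (hb : b ≠ 0)
    (h : HermitianEntries (n + 1)) :
    charCoeffs (hermitianOfEntries (n + 2) (borderEntries a b h)) =
      euclidStep a (charCoeffs (hermitianOfEntries (n + 1) h)) (C (sqLength b) *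
        monicPoly (resolventCoeffs (hermitianOfEntries (n + 1) h) (normalized b))) := by
  have hcol : (fun i : Fin (n + 1) =>
      hermitianOfEntries (n + 2) (borderEntries a b h) i.succ 0) = b :=
    funext (borderEntries_apply_succ_zero a b h)
  have h1 := charCoeffs_eq_euclidStep (isHermitian_hermitianOfEntries (borderEntries a b h))
    (by rw [hcol]; exact hb)
  rw [hcol, borderEntries_apply_zero, borderEntries_submatrix, Complex.ofReal_re] at h1
  exact h1

/-- The law of the coefficients of the characteristic polynomial and of `resolventPoly` for
Lebesgue distributed Hermitian matrices is Lebesgue measure on interlacing pairs. -/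
theorem exists_lintegral_charCoeffs (n : ℕ) : ∃ c : ℝ≥0∞, c ≠ 0 ∧ c ≠ ∞ ∧
    ∀ (v : Fin (n + 1) → ℂ), v ⬝ᵥ star v = 1 →
    ∀ F : (Fin (n + 1) → ℝ) × (Fin n → ℝ) → ℝ≥0∞, Measurable F →
      ∫⁻ h, F (charCoeffs (hermitianOfEntries _ h), resolventCoeffs (hermitianOfEntries _ h) v) =
        c * ∫⁻ x in {x | Interlaced n x.1 x.2}, F x := by
  induction n with
  | zero =>
    refine ⟨1, one_ne_zero, ENNReal.one_ne_top, fun v hv F hF => ?_⟩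
    refine (lintegral_borderEntries
      (hF.comp (measurable_charCoeffs_resolventCoeffs v))).trans ?_
    have hset : {x : (Fin 1 → ℝ) × (Fin 0 → ℝ) | Interlaced 0 x.1 x.2} = univ := by
      ext; simp [Interlaced]
    have h1 : ∀ (a : ℝ) (b : Fin 0 → ℂ) (h : HermitianEntries 0),
        charCoeffs (hermitianOfEntries 1 (borderEntries a b h)) = fun _ => -a := by
      intro a b h
      ext i
      rw [Subsingleton.elim i 0]
      simp [charCoeffs, charpoly_fin_succ, borderEntries_apply_zero]
    have h2 : ∀ A, resolventCoeffs A v = (default : Fin 0 → ℝ) := fun A => Subsingleton.elim _ _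
    have h3 : ∀ G : HermitianEntries 0 → ℝ≥0∞, ∫⁻ h, G h = G default := by
      intro G
      have : G = fun _ => G default := by
        ext h; exact congrArg G (Subsingleton.elim _ _)
      rw [this, lintegral_const]
      have : (volume : Measure (HermitianEntries 0)) univ = 1 := by
        rw [Measure.volume_eq_prod, ← univ_prod_univ, Measure.prod_prod, volume_pi, volume_pi,
          Measure.pi_of_empty, Measure.pi_of_empty]
        simp
      rw [this, mul_one]
    rw [one_mul, hset, setLIntegral_univ]
    refine Eq.trans ?_ (lintegral_prod _ hF.aemeasurable).symm
    have h4 : ∀ p : Fin 1 → ℝ, ∫⁻ q : Fin 0 → ℝ, F (p, q) = F (p, default) := by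
      intro p
      rw [← lintegral_pi_empty (ι := Fin 0) (β := ℝ) (F (p, default))]
      exact lintegral_congr fun q => by rw [Subsingleton.elim q default]
    simp only [Function.comp_apply, h1, h2, h3, h4, lintegral_pi_empty]
    have h6 := lintegral_fin_cons (n := 0) (β := ℝ)
      (G := fun p => F (p, (default : Fin 0 → ℝ))) (hF.comp measurable_prodMk_right)
    refine Eq.trans ?_ h6.symm
    have h5 : ∀ (a : ℝ) (y : Fin 0 → ℝ), (Fin.cons a y : Fin 1 → ℝ) = fun _ => a := by
      intro a y; ext i; exact Fin.cases rfl (fun j => j.elim0) i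
    simp only [h5, lintegral_pi_empty]
    exact lintegral_neg_eq_self (fun a : ℝ => F (fun _ => a, default))
  | succ n ih =>
    obtain ⟨c, hc0, hct, hc⟩ := ih
    obtain ⟨κ, hκ0, hκt, hκ⟩ := exists_lintegral_sqLength n
    refine ⟨c * κ, mul_ne_zero hc0 hκ0, ENNReal.mul_ne_top hct hκt, fun v hv F hF => ?_⟩
    have hFm : Measurable fun y : (ℝ × ℝ) × ((Fin (n + 1) → ℝ) × (Fin n → ℝ)) =>
        F (euclidStep y.1.1 y.2.1 (C y.1.2 * monicPoly y.2.2), y.2.1) := by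
      refine hF.comp (Measurable.prodMk ?_ (by fun_prop))
      exact (measurable_euclidStep n).comp (f := fun y : (ℝ × ℝ) ×
        ((Fin (n + 1) → ℝ) × (Fin n → ℝ)) => (y.2.1, y.1.1, y.1.2, y.2.2)) (by fun_prop)
    set g : ℝ → ℝ → ℝ≥0∞ := fun a r =>
      ∫⁻ x in {x : (Fin (n + 1) → ℝ) × (Fin n → ℝ) | Interlaced n x.1 x.2},
        F (euclidStep a x.1 (C r * monicPoly x.2), x.1) with hg
    have hgm : ∀ a, Measurable (g a) := by
      intro a
      refine Measurable.lintegral_prod_right' (f := fun y : ℝ × ((Fin (n + 1) → ℝ) ×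
        (Fin n → ℝ)) => F (euclidStep a y.2.1 (C y.1 * monicPoly y.2.2), y.2.1)) ?_
      exact hFm.comp (f := fun y : ℝ × ((Fin (n + 1) → ℝ) × (Fin n → ℝ)) => ((a, y.1), y.2))
        (by fun_prop)
    -- The direction b/|b| is a unit vector only off this null set.
    have hae : ∀ᵐ b : Fin (n + 1) → ℂ, b ≠ 0 := by
      have : ({0} : Set (Fin (n + 1) → ℂ))ᶜ ∈ ae volume :=
        compl_mem_ae_iff.mpr (measure_singleton 0)
      exact this
    have hsq : Measurable (sqLength : (Fin (n + 1) → ℂ) → ℝ) := by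
      unfold sqLength
      fun_prop
    have hinner : ∀ a : ℝ, ∫⁻ b : Fin (n + 1) → ℂ, ∫⁻ h : HermitianEntries (n + 1),
        F (charCoeffs (hermitianOfEntries _ (borderEntries a b h)),
          charCoeffs ((hermitianOfEntries _ (borderEntries a b h)).submatrix Fin.succ Fin.succ)) =
        c * κ * ∫⁻ r in Ioi (0 : ℝ), ENNReal.ofReal (r ^ n) * g a r := by
      intro a
      -- For fixed b the induction hypothesis applies in the direction of b, with a constant `c`
      -- that does not depend on it. Only |b|² survives, and its density r^n is exactly the weight
      -- in `lintegral_interlaced_succ`.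
      rw [mul_assoc, ← hκ (g a) (hgm a), ← lintegral_const_mul' _ _ hct]
      refine lintegral_congr_ae ?_
      filter_upwards [hae] with b hb
      have h1 := hc (normalized b) (normalized_dotProduct hb)
        (fun x => F (euclidStep a x.1 (C (sqLength b) * monicPoly x.2), x.1))
        (hFm.comp (f := fun x : (Fin (n + 1) → ℝ) × (Fin n → ℝ) => ((a, sqLength b), x))
          (by fun_prop))
      refine Eq.trans (lintegral_congr fun h => ?_) h1
      rw [charCoeffs_borderEntries a hb, borderEntries_submatrix]
    have hGm : Measurable fun h : HermitianEntries (n + 2) =>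
        F (charCoeffs (hermitianOfEntries _ h),
          charCoeffs ((hermitianOfEntries _ h).submatrix Fin.succ Fin.succ)) := by
      refine hF.comp (((continuous_charCoeffs _).comp (continuous_hermitianOfEntries _)).prodMk
        ((continuous_charCoeffs _).comp ?_)).measurable
      exact (continuous_hermitianOfEntries _).matrix_submatrix _ _
    rw [lintegral_resolventCoeffs_eq_single hF hv, lintegral_borderEntries hGm,
      lintegral_interlaced_succ hF,
      ← lintegral_const_mul' _ _ (ENNReal.mul_ne_top hct hκt)]
    exact lintegral_congr hinner

end Law

/-! ### From roots with prescribed sum to coefficients -/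

section Roots

open Set Polynomial Matrix
open scoped ENNReal

/-- The monic polynomial with the given roots. -/
noncomputable def rootPoly {m : ℕ} (z : Fin m → ℂ) : ℂ[X] := ∏ l, (X - C (z l))

theorem roots_rootPoly {m : ℕ} (z : Fin m → ℂ) : (rootPoly z).roots = Finset.univ.val.map z := by
  have := roots_multiset_prod_X_sub_C (Finset.univ.val.map z)
  rw [Multiset.map_map] at this
  exact this

theorem rootPoly_monic {m : ℕ} (z : Fin m → ℂ) : (rootPoly z).Monic :=
  monic_prod_of_monic _ _ fun _ _ => monic_X_sub_C _

theorem rootPoly_natDegree {m : ℕ} (z : Fin m → ℂ) : (rootPoly z).natDegree = m := by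
  rw [rootPoly, natDegree_prod_of_monic _ _ fun _ _ => monic_X_sub_C _]
  simp

theorem rootPoly_comp_perm {m : ℕ} (z : Fin m → ℂ) (σ : Equiv.Perm (Fin m)) :
    rootPoly (z ∘ σ) = rootPoly z :=
  Equiv.prod_comp σ fun l => X - C (z l)

/-- A measurable embedding of ℂ into ℝ gives a Borel linear order, with which one ordering of
distinct roots can be selected measurably. -/
theorem embeddingReal_injective : Function.Injective (embeddingReal ℂ) :=
  (measurableEmbedding_embeddingReal ℂ).injective

/-- Equal polynomials have equal multisets of roots; sorting both tuples by the auxiliary order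
gives the same tuple. -/
theorem exists_perm_of_rootPoly_eq {m : ℕ} {z w : Fin m → ℂ} (h : rootPoly z = rootPoly w) :
    ∃ σ : Equiv.Perm (Fin m), z = w ∘ σ := by
  have h1 := congrArg roots h
  rw [roots_rootPoly, roots_rootPoly, Fin.univ_val_map, Fin.univ_val_map, Multiset.coe_eq_coe] at h1
  set f : (Fin m → ℂ) → Fin m → ℝ := fun z => embeddingReal ℂ ∘ z with hf
  have h2 : (List.ofFn (f z)).Perm (List.ofFn (f w)) := by
    have := h1.map (embeddingReal ℂ)
    rwa [List.map_ofFn, List.map_ofFn] at this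
  have h3 : f z ∘ Tuple.sort (f z) = f w ∘ Tuple.sort (f w) := by
    refine List.ofFn_injective (List.Perm.eq_of_pairwise'
      (Tuple.monotone_sort (f z)).sortedLE_ofFn.pairwise
      (Tuple.monotone_sort (f w)).sortedLE_ofFn.pairwise ?_)
    exact ((Equiv.Perm.ofFn_comp_perm _ _).trans h2).trans (Equiv.Perm.ofFn_comp_perm _ _).symm
  refine ⟨(Tuple.sort (f z))⁻¹.trans (Tuple.sort (f w)), ?_⟩
  funext i
  have := congrFun h3 ((Tuple.sort (f z))⁻¹ i)
  refine embeddingReal_injective ?_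
  simpa [hf] using this

theorem exists_map_eq_roots {m : ℕ} {P : ℂ[X]} (hd : P.natDegree = m) :
    ∃ z : Fin m → ℂ, P.roots = Finset.univ.val.map z := by
  have hcard : P.roots.toList.length = m := by
    rw [Multiset.length_toList, ← hd]
    exact (IsAlgClosed.splits P).natDegree_eq_card_roots.symm
  subst hcard
  refine ⟨P.roots.toList.get, ?_⟩
  rw [Fin.univ_val_map, List.ofFn_get, Multiset.coe_toList]

theorem rootPoly_eq {m : ℕ} {P : ℂ[X]} (hP : P.Monic) {z : Fin m → ℂ}
    (hz : P.roots = Finset.univ.val.map z) : rootPoly z = P := by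
  rw [(IsAlgClosed.splits P).eq_prod_roots_of_monic hP, hz, Multiset.map_map]
  rfl

/-- The coefficients of the monic polynomial with the given roots. -/
noncomputable def rootCoeffs {m : ℕ} (z : Fin m → ℂ) : Fin m → ℂ := fun i => (rootPoly z).coeff i

theorem monicPoly_rootCoeffs {m : ℕ} (z : Fin m → ℂ) : monicPoly (rootCoeffs z) = rootPoly z := by
  refine monicPoly_coeff ?_ fun k hk => coeff_eq_zero_of_natDegree_lt ?_
  · have := (rootPoly_monic z).coeff_natDegree
    rwa [rootPoly_natDegree] at this
  · rwa [rootPoly_natDegree]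

theorem monicPoly_monic {m : ℕ} (c : Fin m → ℂ) : (monicPoly c).Monic :=
  monic_of_natDegree_le_of_coeff_eq_one m
    (natDegree_le_iff_coeff_eq_zero.mpr fun _ hk => coeff_monicPoly_of_lt c hk)
    (coeff_monicPoly_self c)

theorem monicPoly_natDegree {m : ℕ} (c : Fin m → ℂ) : (monicPoly c).natDegree = m :=
  natDegree_eq_of_le_of_coeff_ne_zero
    (natDegree_le_iff_coeff_eq_zero.mpr fun _ hk => coeff_monicPoly_of_lt c hk)
    (by rw [coeff_monicPoly_self]; exact one_ne_zero)

theorem rootCoeffs_surjective (m : ℕ) :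
    Function.Surjective (rootCoeffs : (Fin m → ℂ) → Fin m → ℂ) := by
  intro c
  obtain ⟨z, hz⟩ := exists_map_eq_roots (monicPoly_natDegree c)
  refine ⟨z, monicPoly_injective ?_⟩
  rw [monicPoly_rootCoeffs, rootPoly_eq (monicPoly_monic c) hz]

theorem rootCoeffs_last {n : ℕ} (z : Fin (n + 1) → ℂ) :
    rootCoeffs z (Fin.last n) = -∑ l, z l := by
  have := prod_X_sub_C_coeff_card_pred Finset.univ z (by simp)
  rw [Finset.card_univ, Fintype.card_fin, Nat.add_sub_cancel] at this
  exact this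

/-- Tuples arranged in increasing order for an auxiliary Borel linear order on the plane. -/
def Ordered {m : ℕ} (z : Fin m → ℂ) : Prop := StrictMono fun l => embeddingReal ℂ (z l)

theorem measurableSet_ordered (m : ℕ) : MeasurableSet {z : Fin m → ℂ | Ordered z} := by
  have : {z : Fin m → ℂ | Ordered z} =
      ⋂ i, ⋂ j, ⋂ _ : i < j, {z | embeddingReal ℂ (z i) < embeddingReal ℂ (z j)} := by
    ext z
    simp only [mem_iInter]
    exact ⟨fun h i j hij => h hij, fun h i j hij => h i j hij⟩
  rw [this]
  refine MeasurableSet.iInter fun i => MeasurableSet.iInter fun j => MeasurableSet.iInter fun _ => ?_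
  exact measurableSet_lt (by fun_prop) (by fun_prop)

theorem exists_perm_ordered {m : ℕ} {z : Fin m → ℂ} (h : Function.Injective z) :
    ∃ σ : Equiv.Perm (Fin m), Ordered (z ∘ σ) := by
  refine ⟨Tuple.sort (embeddingReal ℂ ∘ z), ?_⟩
  exact (Tuple.monotone_sort (embeddingReal ℂ ∘ z)).strictMono_of_injective
    ((embeddingReal_injective.comp h).comp (Equiv.injective _))

theorem Ordered.eq_comp_perm {m : ℕ} {z : Fin m → ℂ} {σ τ : Equiv.Perm (Fin m)}
    (h1 : Ordered (z ∘ σ)) (h2 : Ordered (z ∘ τ)) : z ∘ σ = z ∘ τ := by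
  have h := Tuple.unique_monotone (f := embeddingReal ℂ ∘ z) (σ := σ) (τ := τ)
    (StrictMono.monotone h1) (StrictMono.monotone h2)
  funext i
  exact embeddingReal_injective (congrFun h i)

theorem Ordered.eq_of_rootPoly_eq {m : ℕ} {z w : Fin m → ℂ} (hz : Ordered z) (hw : Ordered w)
    (h : rootPoly z = rootPoly w) : z = w := by
  obtain ⟨σ, rfl⟩ := exists_perm_of_rootPoly_eq h
  exact Ordered.eq_comp_perm (τ := 1) hz hw

/-- The tuple with sum `σ` whose entries of nonzero index are given by `w`. -/
noncomputable def rootTuple {n : ℕ} (σ : ℂ) (w : Fin n → ℂ) : Fin (n + 1) → ℂ :=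
  Fin.cons (σ - ∑ k, w k) w

/-- The coefficients below the two leading ones, for roots with sum `σ`. -/
noncomputable def lowerCoeffs {n : ℕ} (σ : ℂ) (w : Fin n → ℂ) : Fin n → ℂ :=
  fun i => (rootPoly (rootTuple σ w)).coeff i

theorem sum_rootTuple {n : ℕ} (σ : ℂ) (w : Fin n → ℂ) : ∑ l, rootTuple σ w l = σ := by
  simp [rootTuple, Fin.sum_univ_succ]

theorem rootTuple_tail {n : ℕ} (z : Fin (n + 1) → ℂ) :
    rootTuple (∑ l, z l) (fun k => z k.succ) = z := by
  funext l
  refine Fin.cases ?_ (fun k => ?_) l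
  · simp [rootTuple, Fin.sum_univ_succ]
  · simp [rootTuple]

theorem rootCoeffs_rootTuple {n : ℕ} (σ : ℂ) (w : Fin n → ℂ) :
    rootCoeffs (rootTuple σ w) = Fin.snoc (lowerCoeffs σ w) (-σ) := by
  funext i
  refine Fin.lastCases ?_ (fun i => ?_) i
  · rw [rootCoeffs_last, sum_rootTuple, Fin.snoc_last]
  · rw [Fin.snoc_castSucc]; rfl

theorem continuous_rootTuple (n : ℕ) :
    Continuous fun p : ℂ × (Fin n → ℂ) => rootTuple p.1 p.2 := by
  refine continuous_pi fun l => ?_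
  refine Fin.cases ?_ (fun k => ?_) l
  · simp only [rootTuple, Fin.cons_zero]; fun_prop
  · simp only [rootTuple, Fin.cons_succ]; fun_prop

theorem differentiable_coeff_prod {ι E : Type*} [NormedAddCommGroup E] [NormedSpace ℂ E]
    (s : Finset ι) {f : ι → E → ℂ} (hf : ∀ l, Differentiable ℂ (f l)) (k : ℕ) :
    Differentiable ℂ fun x => (∏ l ∈ s, (X - C (f l x))).coeff k := by
  classical
  induction s using Finset.induction_on generalizing k with
  | empty => simp
  | insert a s ha ih =>
    simp only [Finset.prod_insert ha, sub_mul, coeff_sub, coeff_C_mul]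
    refine Differentiable.sub ?_ ((hf a).mul (ih k))
    cases k with
    | zero => simp
    | succ k => simpa using ih k

theorem differentiable_lowerCoeffs {n : ℕ} (σ : ℂ) :
    Differentiable ℂ (lowerCoeffs σ : (Fin n → ℂ) → Fin n → ℂ) := by
  refine differentiable_pi.mpr fun i => ?_
  refine differentiable_coeff_prod Finset.univ (f := fun l w => rootTuple σ w l) (fun l => ?_) i
  refine Fin.cases ?_ (fun k => ?_) l
  · simp only [rootTuple, Fin.cons_zero]; fun_prop
  · simp only [rootTuple, Fin.cons_succ]; fun_prop

theorem measurable_rootCoeffs (m : ℕ) : Measurable (rootCoeffs : (Fin m → ℂ) → Fin m → ℂ) := by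
  refine measurable_pi_lambda _ fun i => ?_
  exact (differentiable_coeff_prod Finset.univ (f := fun (l : Fin m) (z : Fin m → ℂ) => z l)
    (fun l => by fun_prop) i).continuous.measurable

/-- The monic polynomial whose roots are all the entries of `w` except the one of index `k`. -/
noncomputable def cofactorPoly {n : ℕ} (w : Fin n → ℂ) (k : Fin n) : ℂ[X] :=
  ∏ l ∈ Finset.univ.erase k, (X - C (w l))

/-- Keeping the sum fixed, moving w_k by t moves the root of index 0 by -t. Only one quadratic
factor changes, and by a constant, so the directional derivative can be read off exactly. -/
theorem rootPoly_rootTuple_add {n : ℕ} (σ : ℂ) (w : Fin n → ℂ) (k : Fin n) (t : ℂ) :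
    rootPoly (rootTuple σ (w + t • Pi.single k 1)) = rootPoly (rootTuple σ w) +
      C (t * (σ - ∑ j, w j - w k) - t ^ 2) * cofactorPoly w k := by
  have h1 : ∀ v : Fin n → ℂ, rootPoly (rootTuple σ v) =
      (X - C (σ - ∑ j, v j)) * ((X - C (v k)) * cofactorPoly v k) := by
    intro v
    rw [rootPoly, Fin.prod_univ_succ, cofactorPoly,
      Finset.mul_prod_erase Finset.univ (fun l => X - C (v l)) (Finset.mem_univ k)]
    simp [rootTuple]
  have h2 : cofactorPoly (w + t • Pi.single k 1) k = cofactorPoly w k := by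
    refine Finset.prod_congr rfl fun l hl => ?_
    simp [Finset.ne_of_mem_erase hl]
  have h3 : ∑ j, (w + t • Pi.single k 1 : Fin n → ℂ) j = ∑ j, w j + t := by
    simp [Finset.sum_add_distrib, ← Finset.mul_sum]
  rw [h1, h1, h2, h3]
  simp
  ring

theorem fderiv_lowerCoeffs_single {n : ℕ} (σ : ℂ) (w : Fin n → ℂ) (i k : Fin n) :
    fderiv ℂ (lowerCoeffs σ) w (Pi.single k 1) i =
      (σ - ∑ j, w j - w k) * (cofactorPoly w k).coeff i := by
  have h1 := ((differentiable_lowerCoeffs σ w).hasFDerivAt.hasLineDerivAt (Pi.single k (1 : ℂ)))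
  have h2 : HasDerivAt (fun t : ℂ => lowerCoeffs σ (w + t • Pi.single k 1) i)
      (fderiv ℂ (lowerCoeffs σ) w (Pi.single k 1) i) 0 := (hasDerivAt_pi.mp h1) i
  have h3 : (fun t : ℂ => lowerCoeffs σ (w + t • Pi.single k 1) i) = fun t =>
      (rootPoly (rootTuple σ w)).coeff i +
        (t * (σ - ∑ j, w j - w k) - t ^ 2) * (cofactorPoly w k).coeff i := by
    funext t
    rw [lowerCoeffs, rootPoly_rootTuple_add, coeff_add, coeff_C_mul]
  rw [h3] at h2
  refine h2.unique ?_
  have h4 := ((((hasDerivAt_id (0 : ℂ)).mul_const (σ - ∑ j, w j - w k)).sub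
    (hasDerivAt_pow 2 (0 : ℂ))).mul_const ((cofactorPoly w k).coeff i)).const_add
    ((rootPoly (rootTuple σ w)).coeff i)
  simpa using h4

theorem cofactorPoly_natDegree_lt {n : ℕ} (w : Fin n → ℂ) (k : Fin n) :
    (cofactorPoly w k).natDegree < n := by
  rw [cofactorPoly, natDegree_prod_of_monic _ _ fun _ _ => monic_X_sub_C _]
  have : 0 < n := k.pos
  simp
  omega

theorem cofactorPoly_eval {n : ℕ} (w : Fin n → ℂ) (j k : Fin n) :
    (cofactorPoly w k).eval (w j) = if k = j then ∏ l ∈ Finset.univ.erase k, (w k - w l) else 0 := by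
  rw [cofactorPoly, eval_prod]
  split_ifs with h
  · subst h; simp
  · refine Finset.prod_eq_zero (i := j) (by simp [Ne.symm h]) (by simp)

/-- Each unordered pair occurs twice in the product, with opposite signs. -/
theorem norm_prod_erase {n : ℕ} (w : Fin n → ℂ) :
    ‖∏ k, ∏ l ∈ Finset.univ.erase k, (w k - w l)‖ = ‖(vandermonde w).det‖ ^ 2 := by
  have h : ∀ k : Fin n, (Finset.univ.erase k) = Finset.Iio k ∪ Finset.Ioi k := by
    intro k; ext l; simp [lt_or_lt_iff_ne]
  have hd : ∀ k : Fin n, Disjoint (Finset.Iio k) (Finset.Ioi k) := fun k =>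
    Finset.disjoint_left.mpr fun l h1 h2 => by
      simp at h1 h2; exact absurd h1 h2.asymm
  simp only [h, Finset.prod_union (hd _), Finset.prod_mul_distrib, norm_mul, norm_prod,
    det_vandermonde, pow_two]
  congr 1
  · rw [Finset.prod_comm' (t' := Finset.univ) (s' := fun k => Finset.Ioi k) (by simp)]
  · refine Finset.prod_congr rfl fun k _ => Finset.prod_congr rfl fun l _ => norm_sub_rev _ _

/-- Multiplication by the Vandermonde matrix evaluates the cofactor polynomials at the nodes. As in
Lagrange interpolation the result is diagonal, with determinant of modulus |V|², and one factor |V|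
cancels. If two nodes coincide, so do two columns. -/
theorem norm_det_coeff_cofactorPoly {n : ℕ} (w : Fin n → ℂ) :
    ‖(of fun i k : Fin n => (cofactorPoly w k).coeff i).det‖ = ‖(vandermonde w).det‖ := by
  by_cases hw : Function.Injective w
  · have hV : (vandermonde w).det ≠ 0 := det_vandermonde_ne_zero_iff.mpr hw
    have hmul : vandermonde w * (of fun i k : Fin n => (cofactorPoly w k).coeff i) =
        diagonal fun k => ∏ l ∈ Finset.univ.erase k, (w k - w l) := by
      ext j k
      rw [mul_apply, diagonal_apply]
      have := cofactorPoly_eval w j k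
      rw [eval_eq_sum_range' (cofactorPoly_natDegree_lt w k), ← Fin.sum_univ_eq_sum_range
        (fun i => (cofactorPoly w k).coeff i * w j ^ i)] at this
      simp only [vandermonde_apply, of_apply, mul_comm (w j ^ _), this]
      by_cases hjk : j = k
      · subst hjk; simp
      · simp [hjk, Ne.symm hjk]
    have h := congrArg (fun M => ‖M.det‖) hmul
    simp only [det_mul, det_diagonal, norm_mul, norm_prod_erase, pow_two] at h
    exact mul_left_cancel₀ (norm_ne_zero_iff.mpr hV) h
  · have hV : (vandermonde w).det = 0 := by
      by_contra h0
      exact hw (det_vandermonde_ne_zero_iff.mp h0)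
    rw [hV]
    simp only [Function.Injective, not_forall] at hw
    obtain ⟨j, k, hjk, hne⟩ := hw
    rw [det_zero_of_column_eq hne]
    intro i
    have h1 : ∀ v : Fin n → ℂ, ∀ k, rootPoly v = (X - C (v k)) * cofactorPoly v k := fun v k =>
      (Finset.mul_prod_erase Finset.univ (fun l => X - C (v l)) (Finset.mem_univ k)).symm
    have h2 : cofactorPoly w j = cofactorPoly w k := by
      refine mul_left_cancel₀ (X_sub_C_ne_zero (w j)) ?_
      rw [← h1, hjk, ← h1]
    simp [h2]

/-- Column k carries the factor z_0 - w_k. These factors complete the Vandermonde determinant of w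
to that of all n + 1 roots. -/
theorem norm_det_fderiv_lowerCoeffs {n : ℕ} (σ : ℂ) (w : Fin n → ℂ) :
    ‖(fderiv ℂ (lowerCoeffs σ) w).det‖ = ‖(vandermonde (rootTuple σ w)).det‖ := by
  have h1 : LinearMap.toMatrix' (fderiv ℂ (lowerCoeffs σ) w : (Fin n → ℂ) →ₗ[ℂ] Fin n → ℂ) =
      of fun i k => (σ - ∑ j, w j - w k) *
        (of fun i k : Fin n => (cofactorPoly w k).coeff i) i k := by
    ext i k
    rw [LinearMap.toMatrix'_apply]
    have : (fun j' => if j' = k then (1 : ℂ) else 0) = Pi.single k 1 := by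
      ext j; simp [Pi.single_apply]
    simpa [this] using fderiv_lowerCoeffs_single σ w i k
  rw [ContinuousLinearMap.det, ← LinearMap.det_toMatrix', h1, det_mul_row, norm_mul,
    norm_det_coeff_cofactorPoly, det_vandermonde (rootTuple σ w), Fin.prod_univ_succ,
    Fin.prod_Ioi_zero, norm_mul, det_vandermonde]
  congr 1
  · rw [norm_prod, norm_prod]
    exact Finset.prod_congr rfl fun k _ => by rw [norm_sub_rev]; simp [rootTuple]
  · simp only [Fin.prod_Ioi_succ]
    simp [rootTuple]

/-- The change of variables from the roots with a given sum to the coefficients. -/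
theorem lintegral_lowerCoeffs {n : ℕ} (σ : ℂ) (h : (Fin n → ℂ) → ℝ≥0∞) :
    ∫⁻ c, h c = ∫⁻ w in {w | Ordered (rootTuple σ w)},
      ENNReal.ofReal (‖(vandermonde (rootTuple σ w)).det‖ ^ 2) * h (lowerCoeffs σ w) := by
  set D : Set (Fin n → ℂ) := {w | Ordered (rootTuple σ w)} with hD
  have hDm : MeasurableSet D := (measurableSet_ordered (n + 1)).preimage
    ((continuous_rootTuple n).comp (by fun_prop : Continuous fun w : Fin n → ℂ => (σ, w))).measurable
  have hder : ∀ w : Fin n → ℂ, HasFDerivAt (lowerCoeffs σ)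
      ((fderiv ℂ (lowerCoeffs σ) w).restrictScalars ℝ) w := fun w =>
    (differentiable_lowerCoeffs σ w).hasFDerivAt.restrictScalars ℝ
  have hdet : ∀ w : Fin n → ℂ, |((fderiv ℂ (lowerCoeffs σ) w).restrictScalars ℝ).det| =
      ‖(vandermonde (rootTuple σ w)).det‖ ^ 2 := by
    intro w
    -- The real determinant of a complex linear map is the squared modulus of its complex
    -- determinant.
    have h1 : ((fderiv ℂ (lowerCoeffs σ) w).restrictScalars ℝ).det =
        ‖(fderiv ℂ (lowerCoeffs σ) w).det‖ ^ 2 := by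
      rw [← Complex.normSq_eq_norm_sq, ← Algebra.norm_complex_apply]
      exact LinearMap.det_restrictScalars
    rw [h1, norm_det_fderiv_lowerCoeffs, abs_of_nonneg (by positivity)]
  have hinj : InjOn (lowerCoeffs σ) D := by
    intro w hw w' hw' hww
    have h1 : rootPoly (rootTuple σ w) = rootPoly (rootTuple σ w') := by
      rw [← monicPoly_rootCoeffs, ← monicPoly_rootCoeffs, rootCoeffs_rootTuple,
        rootCoeffs_rootTuple, hww]
    have h2 := Ordered.eq_of_rootPoly_eq hw hw' h1
    funext k
    have := congrFun h2 k.succ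
    simpa [rootTuple] using this
  set S : Set (Fin n → ℂ) := {w | ((fderiv ℂ (lowerCoeffs σ) w).restrictScalars ℝ).det = 0}
    with hS
  have hnull : volume (lowerCoeffs σ '' S) = 0 :=
    addHaar_image_eq_zero_of_det_fderivWithin_eq_zero volume
      (fun w _ => (hder w).hasFDerivWithinAt) fun w hw => hw
  -- A polynomial with distinct roots comes from an ordered tuple. One with a repeated root is a
  -- critical value, as the Jacobian is a Vandermonde determinant, and critical values form a null
  -- set by Sard.
  have hcover : (lowerCoeffs σ '' D)ᶜ ⊆ lowerCoeffs σ '' S := by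
    intro c hc
    obtain ⟨z, hz⟩ := rootCoeffs_surjective (n + 1) (Fin.snoc c (-σ))
    have hsum : ∀ τ : Equiv.Perm (Fin (n + 1)), ∑ l, (z ∘ τ) l = σ := by
      intro τ
      have := rootCoeffs_last z
      rw [hz, Fin.snoc_last, neg_inj] at this
      rw [this]
      exact Equiv.sum_comp τ z
    have hlow : ∀ τ : Equiv.Perm (Fin (n + 1)),
        rootTuple σ (fun k => (z ∘ τ) k.succ) = z ∘ τ ∧
        lowerCoeffs σ (fun k => (z ∘ τ) k.succ) = c := by
      intro τ
      have h1 := rootTuple_tail (z ∘ τ)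
      rw [hsum] at h1
      refine ⟨h1, ?_⟩
      funext i
      rw [lowerCoeffs, h1, rootPoly_comp_perm]
      have := congrFun hz i.castSucc
      rwa [Fin.snoc_castSucc] at this
    by_cases hi : Function.Injective z
    · obtain ⟨τ, hτ⟩ := exists_perm_ordered hi
      refine absurd ⟨_, ?_, (hlow τ).2⟩ hc
      change Ordered _
      rw [(hlow τ).1]
      exact hτ
    · refine ⟨_, ?_, (hlow 1).2⟩
      change _ = _
      rw [← abs_eq_zero, hdet, (hlow 1).1]
      have : (vandermonde (z ∘ (1 : Equiv.Perm (Fin (n + 1))))).det = 0 := by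
        by_contra h0
        exact hi (det_vandermonde_ne_zero_iff.mp h0)
      rw [this]
      simp
  have hae : lowerCoeffs σ '' D =ᵐ[volume] univ := by
    rw [Filter.eventuallyEq_univ]
    exact mem_ae_iff.mpr (measure_mono_null hcover hnull)
  rw [← setLIntegral_univ, ← setLIntegral_congr hae,
    lintegral_image_eq_lintegral_abs_det_fderiv_mul volume hDm
      (fun w _ => (hder w).hasFDerivWithinAt) hinj]
  simp only [hdet]

end Roots

/-! ### The hyperplane measure, its symmetry, and the change of variables -/

section DeltaSum

open Set Matrix
open scoped ENNReal

/-- The tuple with sum `α` whose entries of nonzero index are given by `y`. -/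
noncomputable def extendSum (N : ℕ) [NeZero N] (α : ℝ) (y : {l : Fin N // l ≠ 0} → ℝ) :
    Fin N → ℝ :=
  fun l => if hl : l = 0 then α - ∑ k, y k else y ⟨l, hl⟩

theorem deltaSum_eq (N : ℕ) [NeZero N] (α : ℝ) : deltaSum N α = volume.map (extendSum N α) := rfl

theorem continuous_extendSum (N : ℕ) [NeZero N] (α : ℝ) : Continuous (extendSum N α) := by
  refine continuous_pi fun l => ?_
  unfold extendSum
  split_ifs <;> fun_prop

theorem sum_eq_zero_add_subtype {N : ℕ} [NeZero N] (x : Fin N → ℝ) :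
    ∑ l, x l = x 0 + ∑ k : {l : Fin N // l ≠ 0}, x k := by
  rw [Fintype.sum_eq_add_sum_subtype_ne x 0]

theorem sum_extendSum {N : ℕ} [NeZero N] (α : ℝ) (y : {l : Fin N // l ≠ 0} → ℝ) :
    ∑ l, extendSum N α y l = α := by
  rw [sum_eq_zero_add_subtype]
  have : ∀ k : {l : Fin N // l ≠ 0}, extendSum N α y k = y k := fun k => dif_neg k.2
  simp only [this]
  simp [extendSum]

theorem extendSum_restrict {N : ℕ} [NeZero N] {α : ℝ} {x : Fin N → ℝ} (hx : ∑ l, x l = α) :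
    extendSum N α (fun k => x k) = x := by
  funext l
  by_cases hl : l = 0
  · subst hl
    rw [sum_eq_zero_add_subtype] at hx
    simp only [extendSum, dif_pos]
    linarith
  · simp [extendSum, hl]

/-- The action of a permutation on the entries of nonzero index of a tuple with sum `α`. -/
noncomputable def permSum {N : ℕ} [NeZero N] (α : ℝ) (σ : Equiv.Perm (Fin N))
    (y : {l : Fin N // l ≠ 0} → ℝ) : {l : Fin N // l ≠ 0} → ℝ :=
  fun k => extendSum N α y (σ k)

theorem extendSum_permSum {N : ℕ} [NeZero N] (α : ℝ) (σ : Equiv.Perm (Fin N))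
    (y : {l : Fin N // l ≠ 0} → ℝ) : extendSum N α (permSum α σ y) = extendSum N α y ∘ σ :=
  extendSum_restrict (x := extendSum N α y ∘ σ) (by
    exact (Equiv.sum_comp σ (extendSum N α y)).trans (sum_extendSum α y))

theorem extendSum_iterate_permSum {N : ℕ} [NeZero N] (α : ℝ) (σ : Equiv.Perm (Fin N)) (k : ℕ)
    (y : {l : Fin N // l ≠ 0} → ℝ) :
    extendSum N α ((permSum α σ)^[k] y) = extendSum N α y ∘ (σ ^ k : Equiv.Perm (Fin N)) := by
  induction k with
  | zero => rfl
  | succ k ih =>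
    rw [Function.iterate_succ_apply', extendSum_permSum, ih, pow_succ]
    rfl

theorem extendSum_injective {N : ℕ} [NeZero N] (α : ℝ) :
    Function.Injective (extendSum N α) := by
  intro y y' h
  funext k
  have := congrFun h k
  simpa [extendSum, k.2] using this

theorem extendSum_add {N : ℕ} [NeZero N] (α β : ℝ) (y y' : {l : Fin N // l ≠ 0} → ℝ) :
    extendSum N (α + β) (y + y') = extendSum N α y + extendSum N β y' := by
  funext l
  by_cases hl : l = 0
  · simp [extendSum, hl, Finset.sum_add_distrib]; ring
  · simp [extendSum, hl]

/-- Solving for the coordinate 0 breaks the symmetry, but σ still acts on the remaining coordinates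
by an affine map whose order divides that of σ. -/
theorem measurePreserving_permSum {N : ℕ} [NeZero N] (α : ℝ) (σ : Equiv.Perm (Fin N)) :
    MeasurePreserving (permSum α σ) volume volume := by
  let L : ({l : Fin N // l ≠ 0} → ℝ) →ₗ[ℝ] {l : Fin N // l ≠ 0} → ℝ :=
    { toFun := permSum 0 σ
      map_add' := fun y y' => by
        have h := extendSum_add 0 0 y y'
        rw [add_zero] at h
        funext k
        simp [permSum, h]
      map_smul' := fun c y => by
        funext k
        simp only [permSum, extendSum, RingHom.id_apply, Pi.smul_apply, smul_eq_mul]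
        split_ifs
        · rw [← Finset.mul_sum]; ring
        · rfl }
  refine measurePreserving_of_iterate_eq_id volume L (permSum α σ 0) (fun y => ?_)
    (orderOf_pos σ).ne' ?_
  · have h := extendSum_add 0 α y 0
    rw [zero_add, add_zero] at h
    funext k
    simp [permSum, h, L]
  · funext y
    apply extendSum_injective α
    rw [extendSum_iterate_permSum, pow_orderOf_eq_one]
    rfl

theorem measurable_comp_perm {N : ℕ} {β : Type*} [MeasurableSpace β] (σ : Equiv.Perm (Fin N)) :
    Measurable fun z : Fin N → β => z ∘ σ :=
  measurable_pi_lambda _ fun i => measurable_pi_apply (σ i)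

theorem measurePreserving_comp_perm_deltaSum {N : ℕ} [NeZero N] (α : ℝ)
    (σ : Equiv.Perm (Fin N)) :
    MeasurePreserving (fun y : Fin N → ℝ => y ∘ σ) (deltaSum N α) (deltaSum N α) := by
  refine ⟨measurable_comp_perm σ, ?_⟩
  have hm := (continuous_extendSum N α).measurable
  have hp := measurePreserving_permSum α σ
  have h : (fun y : Fin N → ℝ => y ∘ σ) ∘ extendSum N α = extendSum N α ∘ permSum α σ := by
    funext y; exact (extendSum_permSum α σ y).symm
  rw [deltaSum_eq, Measure.map_map (measurable_comp_perm σ) hm, h,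
    ← Measure.map_map hm hp.measurable, hp.map_eq]

theorem measurePreserving_comp_perm_volume {N : ℕ} (σ : Equiv.Perm (Fin N)) :
    MeasurePreserving (fun x : Fin N → ℝ => x ∘ σ) volume volume := by
  refine measurePreserving_of_iterate_eq_id volume (LinearMap.funLeft ℝ ℝ σ) 0
    (fun x => by simp [LinearMap.funLeft]) (orderOf_pos σ).ne' ?_
  have h : ∀ k x, (fun x : Fin N → ℝ => x ∘ σ)^[k] x = x ∘ (σ ^ k : Equiv.Perm (Fin N)) := by
    intro k
    induction k with
    | zero => intro x; rfl
    | succ k ih =>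
      intro x
      rw [Function.iterate_succ_apply', ih, pow_succ]
      rfl
  funext x
  rw [h, pow_orderOf_eq_one]
  rfl

instance sFinite_deltaSum (N : ℕ) [NeZero N] (α : ℝ) : SFinite (deltaSum N α) := by
  rw [deltaSum_eq]
  infer_instance

theorem measurable_mk_complex (N : ℕ) :
    Measurable fun (p : (Fin N → ℝ) × (Fin N → ℝ)) l => (⟨p.1 l, p.2 l⟩ : ℂ) := by
  refine measurable_pi_lambda _ fun l => ?_
  have : (fun p : (Fin N → ℝ) × (Fin N → ℝ) => (⟨p.1 l, p.2 l⟩ : ℂ)) = fun p =>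
      (p.1 l : ℂ) + (p.2 l : ℂ) * Complex.I := by
    funext p; exact Complex.mk_eq_add_mul_I _ _
  rw [this]
  fun_prop

theorem measurePreserving_comp_perm_deltaSumIm {N : ℕ} [NeZero N] (α : ℝ)
    (σ : Equiv.Perm (Fin N)) :
    MeasurePreserving (fun z : Fin N → ℂ => z ∘ σ) (deltaSumIm N α) (deltaSumIm N α) := by
  refine ⟨measurable_comp_perm σ, ?_⟩
  have hp := (measurePreserving_comp_perm_volume σ).prod (measurePreserving_comp_perm_deltaSum α σ)
  have hm := measurable_mk_complex N
  have h : (fun z : Fin N → ℂ => z ∘ σ) ∘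
      (fun (p : (Fin N → ℝ) × (Fin N → ℝ)) l => (⟨p.1 l, p.2 l⟩ : ℂ)) =
      (fun (p : (Fin N → ℝ) × (Fin N → ℝ)) l => (⟨p.1 l, p.2 l⟩ : ℂ)) ∘
        Prod.map (fun x : Fin N → ℝ => x ∘ σ) (fun x : Fin N → ℝ => x ∘ σ) := rfl
  rw [deltaSumIm, Measure.map_map (measurable_comp_perm σ) hm, h,
    ← Measure.map_map hm hp.measurable, hp.map_eq]

theorem prod_norm_sq_eq_vandermonde {N : ℕ} (z : Fin N → ℂ) :
    ∏ j, ∏ k ∈ Finset.Ioi j, ‖z k - z j‖ ^ 2 = ‖(vandermonde z).det‖ ^ 2 := by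
  simp only [det_vandermonde, norm_prod, Finset.prod_pow]

theorem norm_det_vandermonde_comp_perm {N : ℕ} (z : Fin N → ℂ) (σ : Equiv.Perm (Fin N)) :
    ‖(vandermonde (z ∘ σ)).det‖ = ‖(vandermonde z).det‖ := by
  have h : vandermonde (z ∘ σ) = (vandermonde z).submatrix σ id := by
    ext i j; simp [vandermonde_apply]
  rw [h, det_permute, norm_mul]
  rcases Int.units_eq_one_or (Equiv.Perm.sign σ) with h | h <;> simp [h]

theorem eigenvalueWeight_comp_perm {N : ℕ} (α : ℝ) (z : Fin N → ℂ) (σ : Equiv.Perm (Fin N)) :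
    eigenvalueWeight N α (z ∘ σ) = eigenvalueWeight N α z := by
  rw [eigenvalueWeight, eigenvalueWeight, prod_norm_sq_eq_vandermonde, prod_norm_sq_eq_vandermonde,
    norm_det_vandermonde_comp_perm]
  congr 2
  exact Equiv.prod_comp σ fun l => Real.exp (-((z l).re ^ 2 - (z l).im ^ 2))

theorem measurable_det_vandermonde (N : ℕ) :
    Measurable fun z : Fin N → ℂ => ‖(vandermonde z).det‖ := by
  simp only [det_vandermonde, norm_prod]
  fun_prop

theorem measurable_eigenvalueWeight (N : ℕ) (α : ℝ) : Measurable (eigenvalueWeight N α) := by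
  unfold eigenvalueWeight
  fun_prop

theorem measurableSet_im_pos (N : ℕ) : MeasurableSet {z : Fin N → ℂ | ∀ l, 0 < (z l).im} := by
  have : {z : Fin N → ℂ | ∀ l, 0 < (z l).im} = ⋂ l, {z | 0 < (z l).im} := by ext; simp
  rw [this]
  exact MeasurableSet.iInter fun l => measurableSet_lt measurable_const (by fun_prop)

theorem eigenvalueMeasure_map_comp_perm {N : ℕ} [NeZero N] (C α : ℝ) (σ : Equiv.Perm (Fin N)) :
    (eigenvalueMeasure N C α).map (fun z => z ∘ σ) = eigenvalueMeasure N C α := by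
  have hpre : (fun z : Fin N → ℂ => z ∘ σ) ⁻¹' {z | ∀ l, 0 < (z l).im} =
      {z | ∀ l, 0 < (z l).im} := by
    ext z
    exact ⟨fun h l => by simpa using h (σ.symm l), fun h l => h (σ l)⟩
  have hmp := (measurePreserving_comp_perm_deltaSumIm α σ).restrict_preimage
    (measurableSet_im_pos N)
  rw [hpre] at hmp
  ext s hs
  rw [Measure.map_apply (measurable_comp_perm σ) hs, eigenvalueMeasure,
    withDensity_apply _ (measurable_comp_perm σ hs), withDensity_apply _ hs,
    ← hmp.setLIntegral_comp_preimage hs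
      ((measurable_eigenvalueWeight N α).const_mul C).ennreal_ofReal]
  simp only [eigenvalueWeight_comp_perm]

theorem lintegral_deltaSum {n : ℕ} (α : ℝ) {G : (Fin (n + 1) → ℝ) → ℝ≥0∞} (hG : Measurable G) :
    ∫⁻ y, G y ∂deltaSum (n + 1) α =
      ∫⁻ y : Fin n → ℝ, G (Fin.cons (α - ∑ k, y k) y) := by
  have hm := (continuous_extendSum (n + 1) α).measurable
  have hp := volume_measurePreserving_piCongrLeft (fun _ => ℝ)
    (finSuccAboveEquiv (0 : Fin (n + 1)))
  rw [deltaSum_eq, lintegral_map hG hm]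
  refine (hp.lintegral_comp (hG.comp hm)).symm.trans ?_
  refine lintegral_congr fun y => ?_
  have h : ∀ k : Fin n, MeasurableEquiv.piCongrLeft (fun _ => ℝ)
      (finSuccAboveEquiv (0 : Fin (n + 1))) y ⟨k.succ, Fin.succ_ne_zero k⟩ = y k := by
    intro k
    exact Equiv.piCongrLeft_apply_apply (fun _ => ℝ)
      (finSuccAboveEquiv (0 : Fin (n + 1))) y k
  simp only [Function.comp_apply]
  congr 1
  rw [← extendSum_restrict (α := α) (x := Fin.cons (α - ∑ k, y k) y)]
  · congr 1
    funext ⟨l, hl⟩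
    obtain ⟨k, rfl⟩ := Fin.exists_succ_eq_of_ne_zero hl
    rw [h]
    simp
  · simp [Fin.sum_univ_succ]

theorem lintegral_pi_complex {n : ℕ} {G : (Fin n → ℂ) → ℝ≥0∞} (hG : Measurable G) :
    ∫⁻ w, G w = ∫⁻ x : Fin n → ℝ, ∫⁻ y : Fin n → ℝ, G fun l => ⟨x l, y l⟩ := by
  have h1 := volume_preserving_pi
    (fun _ : Fin n => Complex.volume_preserving_equiv_real_prod.symm)
  have h2 := (volume_measurePreserving_arrowProdEquivProdArrow ℝ ℝ (Fin n)).symm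
  refine (h1.lintegral_comp hG).symm.trans
    ((h2.lintegral_comp (hG.comp h1.measurable)).symm.trans ?_)
  exact lintegral_prod _ ((hG.comp h1.measurable).comp h2.measurable).aemeasurable

theorem measurable_rootTuple (n : ℕ) : Measurable fun p : ℂ × (Fin n → ℂ) => rootTuple p.1 p.2 :=
  (continuous_rootTuple n).measurable

/-- Integration against `deltaSumIm` in the coordinates given by the real part of the sum and the
entries of nonzero index. -/
theorem lintegral_deltaSumIm {n : ℕ} (α : ℝ) {G : (Fin (n + 1) → ℂ) → ℝ≥0∞} (hG : Measurable G) :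
    ∫⁻ z, G z ∂deltaSumIm (n + 1) α =
      ∫⁻ s : ℝ, ∫⁻ w : Fin n → ℂ, G (rootTuple ⟨s, α⟩ w) := by
  have hm := measurable_mk_complex (n + 1)
  have hcons : Measurable fun y : Fin n → ℝ => (Fin.cons (α - ∑ k, y k) y : Fin (n + 1) → ℝ) :=
    measurable_fin_cons.comp (f := fun y : Fin n → ℝ => (α - ∑ k, y k, y)) (by fun_prop)
  have hmk : Measurable fun s : ℝ => (⟨s, α⟩ : ℂ) := by
    have : (fun s : ℝ => (⟨s, α⟩ : ℂ)) = fun s : ℝ => (s : ℂ) + (α : ℂ) * Complex.I := by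
      funext s; exact Complex.mk_eq_add_mul_I _ _
    rw [this]
    fun_prop
  have hΦ : Measurable fun x : (Fin (n + 1) → ℝ) × (Fin n → ℝ) =>
      G fun l => ⟨x.1 l, (Fin.cons (α - ∑ k, x.2 k) x.2 : Fin (n + 1) → ℝ) l⟩ :=
    hG.comp (hm.comp (f := fun x : (Fin (n + 1) → ℝ) × (Fin n → ℝ) => (x.1, _))
      (measurable_fst.prodMk (hcons.comp measurable_snd)))
  have hΨ : Measurable fun x : (ℝ × (Fin n → ℝ)) × (Fin n → ℝ) =>
      G (rootTuple ⟨x.1.1, α⟩ fun l => ⟨x.1.2 l, x.2 l⟩) := by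
    refine hG.comp ((measurable_rootTuple n).comp ((hmk.comp (by fun_prop)).prodMk
      ((measurable_mk_complex n).comp (f := fun x : (ℝ × (Fin n → ℝ)) × (Fin n → ℝ) =>
        (x.1.2, x.2)) (by fun_prop))))
  calc ∫⁻ z, G z ∂deltaSumIm (n + 1) α
      = ∫⁻ x : Fin (n + 1) → ℝ, ∫⁻ y, G (fun l => ⟨x l, y l⟩) ∂deltaSum (n + 1) α := by
        rw [deltaSumIm, lintegral_map hG hm]
        exact lintegral_prod _ (hG.comp hm).aemeasurable
    _ = ∫⁻ x : Fin (n + 1) → ℝ, ∫⁻ y : Fin n → ℝ,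
          G (fun l => ⟨x l, (Fin.cons (α - ∑ k, y k) y : Fin (n + 1) → ℝ) l⟩) := by
        refine lintegral_congr fun x => ?_
        exact lintegral_deltaSum α (G := fun y => G fun l => ⟨x l, y l⟩)
          (hG.comp (hm.comp measurable_prodMk_left))
    _ = ∫⁻ a : ℝ, ∫⁻ x : Fin n → ℝ, ∫⁻ y : Fin n → ℝ,
          G (fun l => ⟨(Fin.cons a x : Fin (n + 1) → ℝ) l,
            (Fin.cons (α - ∑ k, y k) y : Fin (n + 1) → ℝ) l⟩) :=
        lintegral_fin_cons (Measurable.lintegral_prod_right' hΦ)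
    _ = ∫⁻ x : Fin n → ℝ, ∫⁻ a : ℝ, ∫⁻ y : Fin n → ℝ,
          G (fun l => ⟨(Fin.cons a x : Fin (n + 1) → ℝ) l,
            (Fin.cons (α - ∑ k, y k) y : Fin (n + 1) → ℝ) l⟩) := by
        refine lintegral_lintegral_swap (Measurable.aemeasurable ?_)
        exact (Measurable.lintegral_prod_right' hΦ).comp measurable_fin_cons
    _ = ∫⁻ x : Fin n → ℝ, ∫⁻ s : ℝ, ∫⁻ y : Fin n → ℝ,
          G (rootTuple ⟨s, α⟩ fun l => ⟨x l, y l⟩) := by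
        refine lintegral_congr fun x => ?_
        -- The real part of the root of index 0 is replaced by the real part s of the sum of all
        -- roots, a translation.
        rw [← lintegral_sub_right_eq_self (fun a : ℝ => ∫⁻ y : Fin n → ℝ,
          G (fun l => ⟨(Fin.cons a x : Fin (n + 1) → ℝ) l,
            (Fin.cons (α - ∑ k, y k) y : Fin (n + 1) → ℝ) l⟩)) (∑ k, x k)]
        refine lintegral_congr fun s => lintegral_congr fun y => ?_
        congr 1
        funext l
        refine Fin.cases ?_ (fun k => ?_) l
        · apply Complex.ext <;> simp [rootTuple]
        · simp [rootTuple]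
    _ = ∫⁻ s : ℝ, ∫⁻ x : Fin n → ℝ, ∫⁻ y : Fin n → ℝ,
          G (rootTuple ⟨s, α⟩ fun l => ⟨x l, y l⟩) := by
        refine (lintegral_lintegral_swap (Measurable.aemeasurable ?_)).symm
        exact Measurable.lintegral_prod_right' hΨ
    _ = _ := by
        refine lintegral_congr fun s => 
          (lintegral_pi_complex (G := fun w => G (rootTuple ⟨s, α⟩ w)) ?_).symm
        exact hG.comp ((measurable_rootTuple n).comp measurable_prodMk_left)

/-- The integral of a symmetric function is a multiple of the integral over ordered tuples. -/
theorem lintegral_eq_factorial_mul {m : ℕ} {μ : Measure (Fin m → ℂ)}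
    (hμ : ∀ σ : Equiv.Perm (Fin m), MeasurePreserving (fun z : Fin m → ℂ => z ∘ σ) μ μ)
    {G : (Fin m → ℂ) → ℝ≥0∞} (hG : Measurable G)
    (hs : ∀ (σ : Equiv.Perm (Fin m)) z, G (z ∘ σ) = G z)
    (h0 : ∀ z, ¬ Function.Injective z → G z = 0) :
    ∫⁻ z, G z ∂μ = (m.factorial : ℝ≥0∞) * ∫⁻ z in {z | Ordered z}, G z ∂μ := by
  set H := {z : Fin m → ℂ | Ordered z}.indicator G with hH
  have hHm : Measurable H := hG.indicator (measurableSet_ordered m)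
  -- A tuple of distinct entries is ordered by exactly one permutation; on all others both sides
  -- vanish.
  have hpt : ∀ z, G z = ∑ σ : Equiv.Perm (Fin m), H (z ∘ σ) := by
    intro z
    by_cases hz : Function.Injective z
    · obtain ⟨σ, hσ⟩ := exists_perm_ordered hz
      have hmem : z ∘ σ ∈ {z : Fin m → ℂ | Ordered z} := hσ
      rw [Finset.sum_eq_single σ]
      · rw [hH, indicator_of_mem hmem, hs]
      · intro τ _ hτ
        refine indicator_of_notMem (fun hτ' => hτ ?_) G
        have h := Ordered.eq_comp_perm (show Ordered (z ∘ τ) from hτ') hσ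
        exact Equiv.ext fun i => hz (congrFun h i)
      · simp
    · rw [h0 z hz]
      refine (Finset.sum_eq_zero fun σ _ => ?_).symm
      by_cases h : z ∘ σ ∈ {z : Fin m → ℂ | Ordered z}
      · rw [hH, indicator_of_mem h, hs, h0 z hz]
      · exact indicator_of_notMem h G
  calc ∫⁻ z, G z ∂μ = ∫⁻ z, ∑ σ : Equiv.Perm (Fin m), H (z ∘ σ) ∂μ := lintegral_congr hpt
    _ = ∑ σ : Equiv.Perm (Fin m), ∫⁻ z, H (z ∘ σ) ∂μ :=
        lintegral_finsetSum _ fun σ _ => hHm.comp (measurable_comp_perm σ)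
    _ = ∑ _σ : Equiv.Perm (Fin m), ∫⁻ z, H z ∂μ :=
        Finset.sum_congr rfl fun σ _ => (hμ σ).lintegral_comp hHm
    _ = _ := by
        rw [Finset.sum_const, Finset.card_univ, Fintype.card_perm, Fintype.card_fin,
          nsmul_eq_mul, lintegral_indicator (measurableSet_ordered m)]

/-- The coefficients of `p - i α q`. -/
noncomputable def perturbedCoeffs {n : ℕ} (α : ℝ) (x : (Fin (n + 1) → ℝ) × (Fin n → ℝ)) :
    Fin (n + 1) → ℂ :=
  Fin.snoc (fun i => (⟨x.1 i.castSucc, -(α * x.2 i)⟩ : ℂ)) (⟨x.1 (Fin.last n), -α⟩ : ℂ)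

theorem measurable_complex_mk : Measurable fun p : ℝ × ℝ => (⟨p.1, p.2⟩ : ℂ) :=
  Complex.measurableEquivRealProd.symm.measurable

theorem measurable_perturbedCoeffs {n : ℕ} (α : ℝ) :
    Measurable (perturbedCoeffs α : (Fin (n + 1) → ℝ) × (Fin n → ℝ) → _) := by
  refine measurable_pi_lambda _ fun i => ?_
  refine Fin.lastCases ?_ (fun i => ?_) i
  · simp only [perturbedCoeffs, Fin.snoc_last]
    exact measurable_complex_mk.comp (f := fun x : (Fin (n + 1) → ℝ) × (Fin n → ℝ) =>
      (x.1 (Fin.last n), -α)) (by fun_prop)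
  · simp only [perturbedCoeffs, Fin.snoc_castSucc]
    exact measurable_complex_mk.comp (f := fun x : (Fin (n + 1) → ℝ) × (Fin n → ℝ) =>
      (x.1 i.castSucc, -(α * x.2 i))) (by fun_prop)

/-- The n free coefficients of q are scaled by -α, whence α^n. The leading one is fixed at 1, which
pins the imaginary part of the sum of the roots to α; on the right the top coefficient is minus that
sum. -/
theorem lintegral_perturbedCoeffs {n : ℕ} {α : ℝ} (hα : 0 < α)
    {G : (Fin (n + 1) → ℂ) → ℝ≥0∞} (hG : Measurable G) :
    ENNReal.ofReal (α ^ n) * ∫⁻ x : (Fin (n + 1) → ℝ) × (Fin n → ℝ), G (perturbedCoeffs α x) =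
      ∫⁻ s : ℝ, ∫⁻ c : Fin n → ℂ, G (Fin.snoc c (-⟨s, α⟩)) := by
  have hGm := hG.comp (measurable_perturbedCoeffs (n := n) α)
  have hsnoc : ∀ b : ℂ, Measurable fun c : Fin n → ℂ => G (Fin.snoc c b) := fun b =>
    hG.comp (measurable_fin_snoc.comp (f := fun c : Fin n → ℂ => (c, b))
      (measurable_id.prodMk measurable_const))
  calc ENNReal.ofReal (α ^ n) * ∫⁻ x : (Fin (n + 1) → ℝ) × (Fin n → ℝ), G (perturbedCoeffs α x)
      = ENNReal.ofReal (α ^ n) * ∫⁻ p, ∫⁻ q : Fin n → ℝ, G (perturbedCoeffs α (p, q)) := by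
        congr 1
        exact lintegral_prod _ hGm.aemeasurable
    _ = ENNReal.ofReal (α ^ n) * ∫⁻ a : ℝ, ∫⁻ p : Fin n → ℝ, ∫⁻ q : Fin n → ℝ,
          G (Fin.snoc (fun i => (⟨p i, -(α * q i)⟩ : ℂ)) ⟨a, -α⟩) := by
        refine congrArg _ ((lintegral_fin_snoc
          (Measurable.lintegral_prod_right' hGm)).trans ?_)
        simp [perturbedCoeffs]
    _ = ∫⁻ a : ℝ, ∫⁻ p : Fin n → ℝ, ENNReal.ofReal (α ^ n) * ∫⁻ q : Fin n → ℝ,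
          G (Fin.snoc (fun i => (⟨p i, -(α * q i)⟩ : ℂ)) ⟨a, -α⟩) := by
        rw [← lintegral_const_mul' _ _ ENNReal.ofReal_ne_top]
        refine lintegral_congr fun a => ?_
        rw [← lintegral_const_mul' _ _ ENNReal.ofReal_ne_top]
    _ = ∫⁻ a : ℝ, ∫⁻ p : Fin n → ℝ, ∫⁻ y : Fin n → ℝ,
          G (Fin.snoc (fun i => (⟨p i, y i⟩ : ℂ)) ⟨a, -α⟩) := by
        refine lintegral_congr fun a => lintegral_congr fun p => ?_
        have hm : Measurable fun y : Fin n → ℝ =>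
            G (Fin.snoc (fun i => (⟨p i, y i⟩ : ℂ)) ⟨a, -α⟩) :=
          (hsnoc ⟨a, -α⟩).comp ((measurable_mk_complex n).comp measurable_prodMk_left)
        exact (lintegral_comp_smul_pi hα (hm.comp measurable_neg)).trans
          (lintegral_neg_eq_self fun y : Fin n → ℝ =>
            G (Fin.snoc (fun i => (⟨p i, y i⟩ : ℂ)) ⟨a, -α⟩))
    _ = ∫⁻ a : ℝ, ∫⁻ c : Fin n → ℂ, G (Fin.snoc c ⟨a, -α⟩) :=
        lintegral_congr fun a => (lintegral_pi_complex (hsnoc _)).symm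
    _ = _ := by
        rw [← lintegral_neg_eq_self fun a : ℝ => ∫⁻ c : Fin n → ℂ, G (Fin.snoc c ⟨a, -α⟩)]
        rfl

/-- The change of variables from the coefficients to the roots, for symmetric functions of the
roots. -/
theorem lintegral_perturbedCoeffs_eq_deltaSumIm {n : ℕ} {α : ℝ} (hα : 0 < α)
    {G : (Fin (n + 1) → ℂ) → ℝ≥0∞} (hG : Measurable G) :
    ((n + 1).factorial : ℝ≥0∞) * (ENNReal.ofReal (α ^ n) *
        ∫⁻ x : (Fin (n + 1) → ℝ) × (Fin n → ℝ), G (perturbedCoeffs α x)) =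
      ∫⁻ z, ENNReal.ofReal (‖(vandermonde z).det‖ ^ 2) * G (rootCoeffs z)
        ∂deltaSumIm (n + 1) α := by
  have hF : Measurable fun z : Fin (n + 1) → ℂ =>
      ENNReal.ofReal (‖(vandermonde z).det‖ ^ 2) * G (rootCoeffs z) :=
    ((measurable_det_vandermonde (n + 1)).pow_const 2).ennreal_ofReal.mul
      (hG.comp (measurable_rootCoeffs (n + 1)))
  rw [lintegral_eq_factorial_mul (measurePreserving_comp_perm_deltaSumIm α) hF,
    lintegral_perturbedCoeffs hα hG, ← lintegral_indicator (measurableSet_ordered (n + 1)),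
    lintegral_deltaSumIm α (hF.indicator (measurableSet_ordered (n + 1)))]
  · congr 1
    refine lintegral_congr fun s => ?_
    rw [lintegral_lowerCoeffs ⟨s, α⟩, ← lintegral_indicator]
    · refine lintegral_congr fun w => ?_
      by_cases hw : w ∈ {w | Ordered (rootTuple ⟨s, α⟩ w)}
      · have hw' : rootTuple ⟨s, α⟩ w ∈ {z : Fin (n + 1) → ℂ | Ordered z} := hw
        rw [indicator_of_mem hw, indicator_of_mem hw', rootCoeffs_rootTuple]
      · have hw' : rootTuple ⟨s, α⟩ w ∉ {z : Fin (n + 1) → ℂ | Ordered z} := hw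
        rw [indicator_of_notMem hw, indicator_of_notMem hw']
    · exact (measurableSet_ordered (n + 1)).preimage
        ((measurable_rootTuple n).comp measurable_prodMk_left)
  · intro σ z
    have h : rootCoeffs (z ∘ σ) = rootCoeffs z := by
      funext i
      rw [rootCoeffs, rootPoly_comp_perm]
      rfl
    rw [norm_det_vandermonde_comp_perm, h]
  · intro z hz
    have : (vandermonde z).det = 0 := by
      by_contra h0
      exact hz (det_vandermonde_ne_zero_iff.mp h0)
    simp [this]

end DeltaSum

/-! ### The Gaussian weight in terms of the roots, and the eigenvalue law -/

section Eigenvalues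

open Set Matrix Polynomial
open scoped ENNReal

/-- This is t² - M² = (t - M)(t + M) under the determinant. -/
theorem charpoly_mul_self_eval_sq {m : Type*} [Fintype m] [DecidableEq m] (M : Matrix m m ℂ)
    (t : ℂ) : (M * M).charpoly.eval (t ^ 2) =
      M.charpoly.eval t * ((-1) ^ Fintype.card m * M.charpoly.eval (-t)) := by
  rw [eval_charpoly, eval_charpoly, eval_charpoly, ← det_neg, ← det_mul]
  congr 1
  have h : scalar m (-t) = -scalar m t := map_neg _ _
  have h2 : scalar m (t ^ 2) = scalar m t * scalar m t := by rw [sq, map_mul]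
  have hc : M * scalar m t = scalar m t * M :=
    ((scalar_commute t (fun _ => Commute.all _ _) M).eq).symm
  rw [h, h2, neg_sub, sub_neg_eq_add, sub_mul, mul_add, mul_add, hc]
  abel

/-- Every complex number is a square t², so the previous factorisation determines the characteristic
polynomial of M², and with it the eigenvalues with multiplicity, without triangularising M. -/
theorem trace_mul_self_eq_sum_sq {m : ℕ} {M : Matrix (Fin m) (Fin m) ℂ} {z : Fin m → ℂ}
    (hz : M.charpoly.roots = Finset.univ.val.map z) : (M * M).trace = ∑ l, z l ^ 2 := by
  have h : (M * M).charpoly = rootPoly fun l => z l ^ 2 := by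
    refine Polynomial.funext fun s => ?_
    obtain ⟨t, rfl⟩ : ∃ t : ℂ, s = t ^ 2 := (IsAlgClosed.exists_pow_nat_eq s two_pos).imp
      fun _ h => h.symm
    rw [charpoly_mul_self_eval_sq, ← rootPoly_eq (charpoly_monic M) hz]
    simp only [rootPoly, eval_prod, eval_sub, eval_X, eval_C]
    rw [← Finset.card_univ, ← Finset.prod_const, ← Finset.prod_mul_distrib,
      ← Finset.prod_mul_distrib]
    exact Finset.prod_congr rfl fun l _ => by ring
  rw [trace_eq_sum_roots_charpoly, h, roots_rootPoly]
  rfl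

/-- The trace of the square of a Hermitian matrix in terms of the eigenvalues of an imaginary rank
one perturbation. -/
theorem re_trace_mul_self {m : ℕ} {A : Matrix (Fin m) (Fin m) ℂ} (hA : A.IsHermitian)
    {v : Fin m → ℂ} (hv : v ⬝ᵥ star v = 1) {α : ℝ} {z : Fin m → ℂ}
    (hz : (A + (Complex.I * α) • vecMulVec v (star v)).charpoly.roots = Finset.univ.val.map z) :
    (A * A).trace.re = ∑ l, ((z l).re ^ 2 - (z l).im ^ 2) + α ^ 2 := by
  set V := vecMulVec v (star v) with hV
  have hVV : (V * V).trace = 1 := by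
    rw [hV, vecMulVec_mul_vecMulVec, dotProduct_comm (star v), hv, one_smul, trace_vecMulVec, hv]
  have hVA : (V * A).trace = (A * V).trace := trace_mul_comm _ _
  -- The cross term 2iα Tr(A V) is then purely imaginary, and the real part of the trace of the
  -- squared perturbation is Tr A² - α².
  have hreal : (A * V).trace.im = 0 := by
    have hVh : Vᴴ = V := by rw [hV, conjTranspose_vecMulVec, star_star]
    have h := trace_conjTranspose (A * V)
    rw [conjTranspose_mul, hVh, hA.eq, hVA] at h
    exact Complex.conj_eq_iff_im.mp h.symm
  have h := trace_mul_self_eq_sum_sq hz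
  have h2 : (A + (Complex.I * α) • V) * (A + (Complex.I * α) • V) =
      A * A + (Complex.I * α) • (A * V) + (Complex.I * α) • (V * A) +
        (Complex.I * α * (Complex.I * α)) • (V * V) := by
    simp only [add_mul, mul_add, smul_mul_assoc, mul_smul_comm, smul_smul, smul_add]
    abel
  rw [h2] at h
  simp only [trace_add, trace_smul, hVV, hVA, smul_eq_mul] at h
  have hre := congrArg Complex.re h
  have hs : (∑ l, z l ^ 2).re = ∑ l, ((z l).re ^ 2 - (z l).im ^ 2) := by
    rw [Complex.re_sum]
    exact Finset.sum_congr rfl fun l _ => by simp [sq]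
  rw [hs] at hre
  rw [← hre]
  simp [hreal]
  ring

theorem monicPoly_perturbedCoeffs {n : ℕ} (α : ℝ) (x : (Fin (n + 1) → ℝ) × (Fin n → ℝ)) :
    monicPoly (perturbedCoeffs α x) = (monicPoly x.1).map Complex.ofRealHom -
      C (Complex.I * α) * (monicPoly x.2).map Complex.ofRealHom := by
  rw [monicPoly_map, monicPoly_map]
  ext k
  rw [coeff_sub, coeff_C_mul]
  rcases lt_trichotomy k n with hk | rfl | hk
  · have h1 := coeff_monicPoly_fin (perturbedCoeffs α x) (Fin.castSucc ⟨k, hk⟩)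
    have h2 := coeff_monicPoly_fin (fun i => Complex.ofRealHom (x.1 i)) (Fin.castSucc ⟨k, hk⟩)
    have h3 := coeff_monicPoly_fin (fun i => Complex.ofRealHom (x.2 i)) ⟨k, hk⟩
    simp only [Fin.val_castSucc] at h1 h2 h3
    rw [h1, h2, h3]
    simp only [perturbedCoeffs, Fin.snoc_castSucc]
    apply Complex.ext <;> simp
  · have h1 := coeff_monicPoly_fin (perturbedCoeffs α x) (Fin.last k)
    have h2 := coeff_monicPoly_fin (fun i => Complex.ofRealHom (x.1 i)) (Fin.last k)
    simp only [Fin.val_last] at h1 h2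
    rw [h1, h2, coeff_monicPoly_self]
    apply Complex.ext <;> simp [perturbedCoeffs]
  · rw [coeff_monicPoly_of_lt (fun i => Complex.ofRealHom (x.2 i)) hk]
    simp only [coeff_monicPoly]
    split_ifs <;> first | omega | simp

theorem charpoly_perturbation {n : ℕ} {A : Matrix (Fin (n + 1)) (Fin (n + 1)) ℂ}
    (hA : A.IsHermitian) {v : Fin (n + 1) → ℂ} (hv : v ⬝ᵥ star v = 1) (α : ℝ) :
    (A + (Complex.I * α) • vecMulVec v (star v)).charpoly =
      monicPoly (perturbedCoeffs α (charCoeffs A, resolventCoeffs A v)) := by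
  rw [charpoly_add_smul, monicPoly_perturbedCoeffs, map_monicPoly_charCoeffs hA,
    map_monicPoly_resolventCoeffs hA hv]

theorem rootCoeffs_eq_iff {m : ℕ} {z : Fin m → ℂ} {c : Fin m → ℂ} :
    rootCoeffs z = c ↔ rootPoly z = monicPoly c := by
  rw [← monicPoly_rootCoeffs]
  exact monicPoly_injective.eq_iff.symm

/-- The Hermite–Biehler theorem. -/
theorem interlaced_iff_im_pos {n : ℕ} {α : ℝ} (hα : 0 < α)
    {x : (Fin (n + 1) → ℝ) × (Fin n → ℝ)} {z : Fin (n + 1) → ℂ}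
    (hz : rootCoeffs z = perturbedCoeffs α x) :
    Interlaced n x.1 x.2 ↔ ∀ l, 0 < (z l).im := by
  rw [rootCoeffs_eq_iff, monicPoly_perturbedCoeffs] at hz
  refine ⟨fun h l => h.im_pos hα ?_, fun h => interlaced_of_im_pos hα h hz.symm⟩
  have h0 : (rootPoly z).eval (z l) = 0 := by
    rw [rootPoly, eval_prod]
    exact Finset.prod_eq_zero (Finset.mem_univ l) (by simp)
  rw [hz, eval_sub, eval_mul, eval_C, eval_map, eval_map, sub_eq_zero] at h0
  exact h0

/-- The coefficients determine the roots up to order. Measurability of the factor descends along the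
measurable surjection from roots to coefficients, so no measurable choice of eigenvalues is needed.
-/
theorem exists_comp_rootCoeffs {m : ℕ} {g : (Fin m → ℂ) → ℝ≥0∞} (hg : Measurable g)
    (hs : ∀ (σ : Equiv.Perm (Fin m)) z, g (z ∘ σ) = g z) :
    ∃ G : (Fin m → ℂ) → ℝ≥0∞, Measurable G ∧ ∀ z, G (rootCoeffs z) = g z := by
  have h : ∀ z, g (Function.surjInv (rootCoeffs_surjective m) (rootCoeffs z)) = g z := by
    intro z
    have hz := Function.surjInv_eq (rootCoeffs_surjective m) (rootCoeffs z)
    rw [rootCoeffs_eq_iff, monicPoly_rootCoeffs] at hz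
    obtain ⟨σ, hσ⟩ := exists_perm_of_rootPoly_eq hz
    rw [hσ, hs]
  refine ⟨fun c => g (Function.surjInv (rootCoeffs_surjective m) c), ?_, h⟩
  rw [← (measurable_rootCoeffs m).measurable_comp_iff_of_surjective (rootCoeffs_surjective m)]
  have hcomp : (fun c => g (Function.surjInv (rootCoeffs_surjective m) c)) ∘ rootCoeffs = g :=
    funext h
  rwa [hcomp]

theorem measurable_trace_sq (N : ℕ) : Measurable fun h : HermitianEntries N =>
    ENNReal.ofReal
      (Real.exp (-(Matrix.trace (hermitianOfEntries N h * hermitianOfEntries N h)).re)) := by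
  have h := continuous_hermitianOfEntries N
  have : Continuous fun h : HermitianEntries N =>
      Real.exp (-(Matrix.trace (hermitianOfEntries N h * hermitianOfEntries N h)).re) := by
    fun_prop
  exact this.measurable.ennreal_ofReal

/-- The joint law of the eigenvalues for the weight `gueWeight`, up to normalisation. -/
theorem lintegral_gueWeight {n : ℕ} {c : ℝ≥0∞} {v : Fin (n + 1) → ℂ} (hv : v ⬝ᵥ star v = 1)
    (hc : ∀ F : (Fin (n + 1) → ℝ) × (Fin n → ℝ) → ℝ≥0∞, Measurable F →
      ∫⁻ h, F (charCoeffs (hermitianOfEntries _ h), resolventCoeffs (hermitianOfEntries _ h) v) =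
        c * ∫⁻ x in {x | Interlaced n x.1 x.2}, F x)
    {α : ℝ} (hα : 0 < α) {G : (Fin (n + 1) → ℂ) → ℝ≥0∞} (hG : Measurable G) :
    ((n + 1).factorial : ℝ≥0∞) * ∫⁻ h, G (perturbedCoeffs α (charCoeffs (hermitianOfEntries _ h),
        resolventCoeffs (hermitianOfEntries _ h) v)) ∂gueWeight (n + 1) =
      c * ∫⁻ z in {z | ∀ l, 0 < (z l).im},
        ENNReal.ofReal (eigenvalueWeight (n + 1) α z) * G (rootCoeffs z)
          ∂deltaSumIm (n + 1) α := by
  set g : (Fin (n + 1) → ℂ) → ℝ≥0∞ := fun z =>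
    ENNReal.ofReal (Real.exp (-(∑ l, ((z l).re ^ 2 - (z l).im ^ 2) + α ^ 2))) with hg
  have hgm : Measurable g := by
    refine Measurable.ennreal_ofReal ?_
    fun_prop
  obtain ⟨W, hW, hWg⟩ := exists_comp_rootCoeffs hgm (fun σ z => by
    simp only [hg, Function.comp_apply]
    rw [Equiv.sum_comp σ fun l => (z l).re ^ 2 - (z l).im ^ 2])
  -- As a function of the coefficients, the half-plane indicator becomes the indicator of
  -- interlacing, by Hermite–Biehler.
  obtain ⟨U, hU, hUg⟩ := exists_comp_rootCoeffs
    (g := {z : Fin (n + 1) → ℂ | ∀ l, 0 < (z l).im}.indicator 1)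
    (measurable_one.indicator (measurableSet_im_pos (n + 1))) (fun σ z => by
      have h : z ∘ σ ∈ {z : Fin (n + 1) → ℂ | ∀ l, 0 < (z l).im} ↔
          z ∈ {z : Fin (n + 1) → ℂ | ∀ l, 0 < (z l).im} :=
        ⟨fun h l => by simpa using h (σ.symm l), fun h l => h (σ l)⟩
      by_cases hz : z ∈ {z : Fin (n + 1) → ℂ | ∀ l, 0 < (z l).im}
      · rw [indicator_of_mem hz, indicator_of_mem (h.mpr hz)]; rfl
      · rw [indicator_of_notMem hz, indicator_of_notMem (mt h.mp hz)])
  have hpm := measurable_perturbedCoeffs (n := n) α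
  have hUI : ∀ x, U (perturbedCoeffs α x) =
      {x : (Fin (n + 1) → ℝ) × (Fin n → ℝ) | Interlaced n x.1 x.2}.indicator 1 x := by
    intro x
    obtain ⟨z, hz⟩ := rootCoeffs_surjective (n + 1) (perturbedCoeffs α x)
    have h : x ∈ {x : (Fin (n + 1) → ℝ) × (Fin n → ℝ) | Interlaced n x.1 x.2} ↔
        z ∈ {z : Fin (n + 1) → ℂ | ∀ l, 0 < (z l).im} := interlaced_iff_im_pos hα hz
    rw [← hz, hUg]
    by_cases hx : x ∈ {x : (Fin (n + 1) → ℝ) × (Fin n → ℝ) | Interlaced n x.1 x.2}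
    · rw [indicator_of_mem hx, indicator_of_mem (h.mp hx)]; rfl
    · rw [indicator_of_notMem hx, indicator_of_notMem (mt h.mpr hx)]
  have htr : ∀ h : HermitianEntries (n + 1), ENNReal.ofReal (Real.exp
      (-(Matrix.trace (hermitianOfEntries _ h * hermitianOfEntries _ h)).re)) =
      W (perturbedCoeffs α (charCoeffs (hermitianOfEntries _ h),
        resolventCoeffs (hermitianOfEntries _ h) v)) := by
    intro h
    have hA := isHermitian_hermitianOfEntries h
    obtain ⟨z, hz⟩ := rootCoeffs_surjective (n + 1) (perturbedCoeffs α
      (charCoeffs (hermitianOfEntries _ h), resolventCoeffs (hermitianOfEntries _ h) v))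
    rw [← hz, hWg, hg, re_trace_mul_self hA hv (α := α) (z := z)]
    rw [charpoly_perturbation hA hv, ← hz, monicPoly_rootCoeffs, roots_rootPoly]
  have hGWU : Measurable fun c => U c * (W c * G c) := hU.mul (hW.mul hG)
  have h1 : ∫⁻ h, G (perturbedCoeffs α (charCoeffs (hermitianOfEntries _ h),
        resolventCoeffs (hermitianOfEntries _ h) v)) ∂gueWeight (n + 1) =
      c * ∫⁻ x, U (perturbedCoeffs α x) * (W (perturbedCoeffs α x) * G (perturbedCoeffs α x)) := by
    refine (lintegral_withDensity_eq_lintegral_mul _ (measurable_trace_sq _)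
      (hG.comp (hpm.comp (measurable_charCoeffs_resolventCoeffs v)))).trans ?_
    simp only [Pi.mul_apply, htr, Function.comp_apply]
    refine (hc (fun x => W (perturbedCoeffs α x) * G (perturbedCoeffs α x))
      ((hW.comp hpm).mul (hG.comp hpm))).trans ?_
    rw [← lintegral_indicator (measurableSet_interlaced n)]
    congr 1
    refine lintegral_congr fun x => ?_
    rw [hUI]
    by_cases hx : x ∈ {x : (Fin (n + 1) → ℝ) × (Fin n → ℝ) | Interlaced n x.1 x.2}
    · rw [indicator_of_mem hx, indicator_of_mem hx, Pi.one_apply, one_mul]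
    · rw [indicator_of_notMem hx, indicator_of_notMem hx, zero_mul]
  have hαn : ENNReal.ofReal (α ^ n) ≠ 0 := by simpa using pow_pos hα n
  have h2 := lintegral_perturbedCoeffs_eq_deltaSumIm hα hGWU
  rw [h1, ← lintegral_indicator (measurableSet_im_pos _), mul_left_comm]
  congr 1
  -- Multiplying by α^n brings in the change of variables, and cancels the power of α in the
  -- denominator of `eigenvalueWeight`.
  rw [← ENNReal.mul_right_inj hαn ENNReal.ofReal_ne_top, mul_left_comm, h2,
    ← lintegral_const_mul' _ _ ENNReal.ofReal_ne_top]
  refine lintegral_congr fun z => ?_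
  rw [hUg, hWg]
  by_cases hz : z ∈ {z : Fin (n + 1) → ℂ | ∀ l, 0 < (z l).im}
  · rw [indicator_of_mem hz, indicator_of_mem hz, Pi.one_apply, one_mul, hg, ← mul_assoc,
      ← mul_assoc, ← ENNReal.ofReal_mul (by positivity), ← ENNReal.ofReal_mul (by positivity)]
    congr 2
    rw [eigenvalueWeight, prod_norm_sq_eq_vandermonde, ← Real.exp_sum, neg_add, Real.exp_add,
      Finset.sum_neg_distrib, Nat.add_sub_cancel]
    field_simp
  · rw [indicator_of_notMem hz, indicator_of_notMem hz, zero_mul, mul_zero, mul_zero]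

/-- Tr A² is the sum of |A_ij|² over all pairs; the entries below the diagonal are dropped. The
inequality suffices to dominate the weight by a product of Gaussians. -/
theorem sum_sq_le_re_trace {N : ℕ} (h : HermitianEntries N) :
    ∑ i, h.1 i ^ 2 + ∑ p, ‖h.2 p‖ ^ 2 ≤
      (Matrix.trace (hermitianOfEntries N h * hermitianOfEntries N h)).re := by
  set A := hermitianOfEntries N h with hA
  have htr : (A * A).trace.re = ∑ p : Fin N × Fin N, ‖A p.1 p.2‖ ^ 2 := by
    rw [Fintype.sum_prod_type, trace, Complex.re_sum]
    refine Finset.sum_congr rfl fun i _ => ?_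
    rw [diag_apply, mul_apply, Complex.re_sum]
    refine Finset.sum_congr rfl fun j _ => ?_
    have hji : A j i = star (A i j) := ((isHermitian_hermitianOfEntries h).apply j i).symm
    rw [hji, ← Complex.normSq_eq_norm_sq, Complex.normSq_apply]
    simp
  rw [htr]
  have h1 : ∑ i, h.1 i ^ 2 = ∑ p ∈ Finset.univ.filter (fun p : Fin N × Fin N => p.1 = p.2),
      ‖A p.1 p.2‖ ^ 2 := by
    refine Finset.sum_bij (fun i _ => (i, i)) (by simp) (by simp) ?_ ?_
    · rintro ⟨i, j⟩ hij
      obtain rfl : i = j := by simpa using hij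
      exact ⟨i, Finset.mem_univ _, rfl⟩
    · intro i _
      simp [hA, hermitianOfEntries]
  have h2 : ∑ p, ‖h.2 p‖ ^ 2 = ∑ p ∈ Finset.univ.filter (fun p : Fin N × Fin N => p.1 < p.2),
      ‖A p.1 p.2‖ ^ 2 := by
    rw [Finset.sum_subtype (p := fun p : Fin N × Fin N => p.1 < p.2) _ (by simp)]
    refine Finset.sum_congr rfl fun p _ => ?_
    simp [hA, hermitianOfEntries, p.2]
  rw [h1, h2, ← Finset.sum_union]
  · exact Finset.sum_le_sum_of_subset_of_nonneg (Finset.subset_univ _) fun _ _ _ => by positivity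
  · rw [Finset.disjoint_filter]
    intro p _ hp hp'
    exact hp'.ne hp

theorem integrable_exp_neg_norm_sq : Integrable fun z : ℂ => Real.exp (-‖z‖ ^ 2) := by
  have h := GaussianFourier.integrable_cexp_neg_mul_sq_norm_add (b := 1) (by simp) 0 (0 : ℂ)
  refine h.norm.congr (Filter.Eventually.of_forall fun z => ?_)
  simp [Complex.norm_exp, ← Complex.ofReal_pow]

theorem gueWeight_univ_ne_top (N : ℕ) : gueWeight N univ ≠ ∞ := by
  have hR : Integrable fun x : ℝ => Real.exp (-x ^ 2) := by
    simpa using integrable_exp_neg_mul_sq one_pos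
  have h1 : Integrable fun x : Fin N → ℝ => ∏ i, Real.exp (-x i ^ 2) :=
    Integrable.fintype_prod fun _ => hR
  have h2 : Integrable fun x : {p : Fin N × Fin N // p.1 < p.2} → ℂ =>
      ∏ p, Real.exp (-‖x p‖ ^ 2) :=
    Integrable.fintype_prod fun _ => integrable_exp_neg_norm_sq
  have h3 := h1.mul_prod h2
  rw [gueWeight, withDensity_apply _ MeasurableSet.univ, Measure.restrict_univ]
  refine ne_top_of_le_ne_top h3.lintegral_lt_top.ne (lintegral_mono fun h => ?_)
  refine ENNReal.ofReal_le_ofReal ?_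
  rw [← Real.exp_sum, ← Real.exp_sum, ← Real.exp_add, Real.exp_le_exp, Finset.sum_neg_distrib,
    Finset.sum_neg_distrib, ← neg_add, neg_le_neg_iff]
  exact sum_sq_le_re_trace h

theorem gueWeight_univ_ne_zero (N : ℕ) : gueWeight N univ ≠ 0 := by
  rw [gueWeight, withDensity_apply _ MeasurableSet.univ, Measure.restrict_univ, Ne,
    lintegral_eq_zero_iff (measurable_trace_sq N)]
  intro h
  have h2 : ∀ᵐ _ : HermitianEntries N, False := by
    filter_upwards [h] with x hx
    simp only [Pi.zero_apply, ENNReal.ofReal_eq_zero] at hx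
    exact (Real.exp_pos _).not_ge hx
  rw [Filter.eventually_false_iff_eq_bot, ae_eq_bot] at h2
  exact (isOpen_univ.measure_pos (volume : Measure (HermitianEntries N)) univ_nonempty).ne'
    (by rw [h2]; rfl)

/-- The constant is c / (Z N!), with Z the total mass of `gueWeight` and c from the law of (p, q).
For an arbitrary enumeration of the eigenvalues, a symmetric test function depends only on the
coefficients of the characteristic polynomial, hence measurably on the entries. -/
theorem isEigenvalueLaw_rank_one {n : ℕ} {c : ℝ≥0∞} (hctop : c ≠ ∞)
    {v : Fin (n + 1) → ℂ} (hv : v ⬝ᵥ star v = 1)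
    (hc : ∀ F : (Fin (n + 1) → ℝ) × (Fin n → ℝ) → ℝ≥0∞, Measurable F →
      ∫⁻ h, F (charCoeffs (hermitianOfEntries _ h), resolventCoeffs (hermitianOfEntries _ h) v) =
        c * ∫⁻ x in {x | Interlaced n x.1 x.2}, F x)
    {α : ℝ} (hα : 0 < α) {Ω : Type*} [MeasurableSpace Ω] {P : Measure Ω}
    {A : Ω → Matrix (Fin (n + 1)) (Fin (n + 1)) ℂ} (hA : IsGUE (n + 1) A P) :
    IsEigenvalueLaw (fun ω => A ω + (Complex.I * (α : ℂ)) • vecMulVec v (star v)) P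
      (eigenvalueMeasure (n + 1)
        ((gueWeight (n + 1) univ)⁻¹ * ((n + 1).factorial : ℝ≥0∞)⁻¹ * c).toReal α) := by
  refine ⟨eigenvalueMeasure_map_comp_perm _ α, fun z hz f hf hs => ?_⟩
  obtain ⟨h, hlaw, hAh⟩ := hA
  obtain ⟨G, hG, hGf⟩ := exists_comp_rootCoeffs hf hs
  have hzG : ∀ ω, f (z ω) = G (perturbedCoeffs α (charCoeffs (hermitianOfEntries _ (h ω)),
      resolventCoeffs (hermitianOfEntries _ (h ω)) v)) := by
    intro ω
    have hroot := rootPoly_eq (charpoly_monic _) (hz ω)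
    rw [hAh, charpoly_perturbation (isHermitian_hermitianOfEntries _) hv,
      ← rootCoeffs_eq_iff] at hroot
    rw [← hroot, hGf]
  have hm := hG.comp ((measurable_perturbedCoeffs α).comp
    (measurable_charCoeffs_resolventCoeffs v))
  have hfac : ((n + 1).factorial : ℝ≥0∞) ≠ 0 := by exact_mod_cast (n + 1).factorial_ne_zero
  have hZ := ENNReal.inv_ne_top.mpr (gueWeight_univ_ne_zero (n + 1))
  have hCtop : (gueWeight (n + 1) univ)⁻¹ * ((n + 1).factorial : ℝ≥0∞)⁻¹ * c ≠ ∞ :=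
    ENNReal.mul_ne_top (ENNReal.mul_ne_top hZ (ENNReal.inv_ne_top.mpr hfac)) hctop
  have hmain := lintegral_gueWeight hv hc hα hG
  calc ∫⁻ ω, f (z ω) ∂P
      = ∫⁻ x, G (perturbedCoeffs α (charCoeffs (hermitianOfEntries _ x),
          resolventCoeffs (hermitianOfEntries _ x) v)) ∂gueEntriesLaw (n + 1) := by
        simp only [hzG]
        exact hlaw.lintegral_comp hm.aemeasurable
    _ = (gueWeight (n + 1) univ)⁻¹ * (((n + 1).factorial : ℝ≥0∞)⁻¹ *
          (((n + 1).factorial : ℝ≥0∞) * ∫⁻ x, G (perturbedCoeffs α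
            (charCoeffs (hermitianOfEntries _ x), resolventCoeffs (hermitianOfEntries _ x) v))
              ∂gueWeight (n + 1))) := by
        rw [gueEntriesLaw, lintegral_smul_measure, smul_eq_mul,
          ENNReal.inv_mul_cancel_left hfac (ENNReal.natCast_ne_top _)]
    _ = (gueWeight (n + 1) univ)⁻¹ * ((n + 1).factorial : ℝ≥0∞)⁻¹ * c *
          ∫⁻ w in {z | ∀ l, 0 < (z l).im}, ENNReal.ofReal (eigenvalueWeight (n + 1) α w) * f w
            ∂deltaSumIm (n + 1) α := by
        rw [hmain]
        simp only [hGf, mul_assoc]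
    _ = ∫⁻ w, f w ∂eigenvalueMeasure (n + 1) _ α := by
        rw [eigenvalueMeasure, lintegral_withDensity_eq_lintegral_mul _
          ((measurable_eigenvalueWeight _ α).const_mul _).ennreal_ofReal hf,
          ← lintegral_const_mul' _ _ hCtop]
        refine lintegral_congr fun w => ?_
        rw [Pi.mul_apply, ENNReal.ofReal_mul ENNReal.toReal_nonneg, ENNReal.ofReal_toReal hCtop]
        ring

theorem diagOne_eq_vecMulVec (n : ℕ) :
    diagOne (n + 1) = vecMulVec (Pi.single 0 1) (star (Pi.single 0 1)) := by
  ext i j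
  rw [diagOne, vecMulVec_apply, diagonal_apply]
  by_cases hi : i = 0 <;> by_cases hj : j = 0 <;> simp [hi, hj, eq_comm]

theorem unitOnes_dotProduct (n : ℕ) : unitOnes (n + 1) ⬝ᵥ star (unitOnes (n + 1)) = 1 := by
  have h : ∀ i, unitOnes (n + 1) i * star (unitOnes (n + 1)) i = ((1 / (n + 1 : ℝ) : ℝ) : ℂ) := by
    intro i
    rw [Pi.star_apply, unitOnes]
    have : star ((1 / Real.sqrt (n + 1 : ℕ) : ℝ) : ℂ) = ((1 / Real.sqrt (n + 1 : ℕ) : ℝ) : ℂ) :=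
      Complex.conj_ofReal _
    rw [this, ← Complex.ofReal_mul, div_mul_div_comm, Real.mul_self_sqrt (by positivity)]
    simp
  rw [dotProduct, Finset.sum_congr rfl fun i _ => h i]
  have : (n + 1 : ℂ) ≠ 0 := by exact_mod_cast n.succ_ne_zero
  simp [this]

end Eigenvalues

end PerturbedGUE

theorem proposition4p1 (N : ℕ) [NeZero N] :
    ∃ C : ℝ, 0 < C ∧ ∀ α : ℝ, 0 < α →
      ∀ (Ω : Type*) [MeasurableSpace Ω] (P : Measure Ω) [IsProbabilityMeasure P]
        (A : Ω → Matrix (Fin N) (Fin N) ℂ), PerturbedGUE.IsGUE N A P →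
        PerturbedGUE.IsEigenvalueLaw
          (fun ω => A ω + (Complex.I * (α : ℂ)) • PerturbedGUE.diagOne N) P
          (PerturbedGUE.eigenvalueMeasure N C α) ∧
        PerturbedGUE.IsEigenvalueLaw
          (fun ω => A ω + (Complex.I * (α : ℂ)) • PerturbedGUE.onesProjection N) P
          (PerturbedGUE.eigenvalueMeasure N C α) := by
  obtain ⟨n, rfl⟩ := Nat.exists_eq_succ_of_ne_zero (NeZero.ne N)
  -- The constant is obtained before any direction or α is chosen, so one value serves both matrices
  -- and all α.
  obtain ⟨c, hc0, hctop, hc⟩ := PerturbedGUE.exists_lintegral_charCoeffs n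
  have hfac : ((n + 1).factorial : ENNReal) ≠ 0 := by exact_mod_cast (n + 1).factorial_ne_zero
  have hsingle : (Pi.single 0 1 : Fin (n + 1) → ℂ) ⬝ᵥ star (Pi.single 0 1) = 1 := by simp
  refine ⟨((PerturbedGUE.gueWeight (n + 1) Set.univ)⁻¹ *
    ((n + 1).factorial : ENNReal)⁻¹ * c).toReal, ENNReal.toReal_pos ?_ ?_,
    fun α hα Ω _ P _ A hA => ⟨?_, ?_⟩⟩
  · exact mul_ne_zero (mul_ne_zero
      (ENNReal.inv_ne_zero.mpr (PerturbedGUE.gueWeight_univ_ne_top _))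
      (ENNReal.inv_ne_zero.mpr (ENNReal.natCast_ne_top _))) hc0
  · exact ENNReal.mul_ne_top (ENNReal.mul_ne_top
      (ENNReal.inv_ne_top.mpr (PerturbedGUE.gueWeight_univ_ne_zero _))
      (ENNReal.inv_ne_top.mpr hfac)) hctop
  · have h := PerturbedGUE.isEigenvalueLaw_rank_one hctop hsingle (hc _ hsingle) hα hA
    rw [← PerturbedGUE.diagOne_eq_vecMulVec] at h
    exact h
  · exact PerturbedGUE.isEigenvalueLaw_rank_one hctop (PerturbedGUE.unitOnes_dotProduct n)
      (hc _ (PerturbedGUE.unitOnes_dotProduct n)) hα hA
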